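/- Let $d\ge 5$. For $\lambda>0$ with $\lambda^2\in\mathbb N$ and $f:\mathbb Z^d\to\mathbb C$ put $$A_\lambda f(n)=\frac1{N_\lambda}\sum_{m\in\mathbb Z^d,\ |m|=\lambda}f(n-m),\qquad N_\lambda=\#\{m\in\mathbb Z^d:|m|=\lambda\},$$ where $|\cdot|$ is the Euclidean norm. For $f\in\ell^2(\mathbb Z^d)$ let $\widehat f(\alpha)=\sum_{n\in\mathbb Z^d}f(n)e^{-2\pi i n\cdot\alpha}$ be its Fourier transform (the series converging in $L^2(\mathbb T^d)$, $\mathbb T=\mathbb R/\mathbb Z$). For integers $j,k\ge 0$ let $q_j=\operatorname{lcm}\{1,2,\dots,2^j\}$ and let $$\Omega_{j,k}=\{\alpha\in\mathbb T^d:\ \alpha\in[-2^{j-k},2^{j-k}]^d+(q_j^{-1}\mathbb Z)^d\}.$$ Then there is a constant $C>0$ depending only on $d$ such that for all $k,j\in\mathbb N$ with $1\le j\le\log_2 k-2$ and all $f\in\ell^2(\mathbb Z^d)$ whose Fourier transform is supported in the complement of $\Omega_{j,k}$ (that is, $\widehat f=0$ almost everywhere on $\Omega_{j,k}$), $$\Bigl\|\sup_{2^k\le\lambda\le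 2^{k+1},\ \lambda^2\in\mathbb N}|A_\lambda f|\Bigr\|_{\ell^2(\mathbb Z^d)}\le C\,2^{-j/2}j^{-1}\,\|f\|_{\ell^2(\mathbb Z^d)}.$$ -/

import Mathlib

open MeasureTheory
open scoped ENNReal

noncomputable section

namespace DiscreteSpherical

/-- The discrete sphere `{m ∈ ℤ^d : |m| = lam}`, with `|m|` the Euclidean norm. -/
def sphereSet (d : ℕ) (lam : ℝ) : Set (Fin d → ℤ) :=
  {m | Real.sqrt (∑ i, (m i : ℝ) ^ 2) = lam}

theorem sphereSet_finite (d : ℕ) (lam : ℝ) : (sphereSet d lam).Finite := by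
  refine (Set.finite_Icc (fun _ : Fin d => -⌈lam⌉) (fun _ => ⌈lam⌉)).subset ?_
  intro m hm
  have key : ∀ i, |(m i : ℝ)| ≤ lam := by
    intro i
    have h : Real.sqrt (∑ i, (m i : ℝ) ^ 2) = lam := hm
    rw [← h]
    refine Real.abs_le_sqrt ?_
    exact Finset.single_le_sum (f := fun i => (m i : ℝ) ^ 2) (fun _ _ => sq_nonneg _)
      (Finset.mem_univ i)
  have key' : ∀ i, |m i| ≤ ⌈lam⌉ := by
    intro i
    have h := (key i).trans (Int.le_ceil lam)
    exact_mod_cast h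
  exact ⟨fun i => (abs_le.mp (key' i)).1, fun i => (abs_le.mp (key' i)).2⟩

/-- The discrete sphere of radius `lam` as a finite set; its cardinality is `N_lam`. -/
def sphere (d : ℕ) (lam : ℝ) : Finset (Fin d → ℤ) := (sphereSet_finite d lam).toFinset

/-- The spherical average `A_lam f (n) = N_lam⁻¹ ∑_{|m| = lam} f (n - m)`. -/
def sphericalAverage {d : ℕ} (lam : ℝ) (f : (Fin d → ℤ) → ℂ) (n : Fin d → ℤ) : ℂ :=
  ((sphere d lam).card : ℂ)⁻¹ * ∑ m ∈ sphere d lam, f (n - m)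

/-- The radii of the dyadic scale `k`: `2^k ≤ lam ≤ 2^(k+1)` with `lam^2` a natural number. -/
def dyadicRadii (k : ℕ) : Set ℝ :=
  {lam | 2 ^ k ≤ lam ∧ lam ≤ 2 ^ (k + 1) ∧ ∃ N : ℕ, lam ^ 2 = N}

/-- The maximal function at the dyadic scale `k`, `sup |A_lam f|` over the radii above. -/
def dyadicMaximal {d : ℕ} (k : ℕ) (f : (Fin d → ℤ) → ℂ) (n : Fin d → ℤ) : ℝ≥0∞ :=
  ⨆ lam ∈ dyadicRadii k, ‖sphericalAverage lam f n‖ₑ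

/-- The `ℓ²(ℤ^d)` norm of a function with values in `[0, ∞]`. -/
def l2Norm {d : ℕ} (g : (Fin d → ℤ) → ℝ≥0∞) : ℝ≥0∞ := (∑' n, g n ^ 2) ^ (1 / 2 : ℝ)

/-- The Haar probability measure on the torus `𝕋^d = (ℝ / ℤ)^d`. -/
abbrev torusMeasure (d : ℕ) : Measure (UnitAddTorus (Fin d)) :=
  Measure.pi fun _ => AddCircle.haarAddCircle

/-- The character `α ↦ exp (-2 π i n · α)` as an element of `L²(𝕋^d)`. -/
def char {d : ℕ} (n : Fin d → ℤ) : Lp ℂ 2 (torusMeasure d) :=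
  ContinuousMap.toLp (E := ℂ) 2 (torusMeasure d) ℂ (UnitAddTorus.mFourier (-n))

theorem char_orthonormal (d : ℕ) : Orthonormal ℂ (char (d := d)) :=
  (UnitAddTorus.orthonormal_mFourier (d := Fin d)).comp _ neg_injective

/-- The Fourier transform `f̂(α) = ∑ f(n) exp (-2 π i n · α)` of `f ∈ ℓ²(ℤ^d)`, the series
converging unconditionally in `L²(𝕋^d)`. -/
def fourierTransform {d : ℕ} (f : lp (fun _ : Fin d → ℤ => ℂ) 2) : Lp ℂ 2 (torusMeasure d) :=
  ∑' n, f n • char n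

theorem hasSum_fourierTransform {d : ℕ} (f : lp (fun _ : Fin d → ℤ => ℂ) 2) :
    HasSum (fun n => f n • char n) (fourierTransform f) :=
  ((char_orthonormal d).orthogonalFamily.summable_of_lp f).hasSum

/-- For absolutely summable `f` this is the function given by the pointwise series. -/
theorem fourierTransform_ae_eq {d : ℕ} (f : lp (fun _ : Fin d → ℤ => ℂ) 2)
    (hf : Summable fun n => ‖f n‖) :
    fourierTransform f =ᵐ[torusMeasure d]
      fun α => ∑' n, f n * UnitAddTorus.mFourier (-n) α := by
  have hs : Summable fun n => f n • UnitAddTorus.mFourier (d := Fin d) (-n) := by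
    refine Summable.of_norm ?_
    simpa [norm_smul, UnitAddTorus.mFourier_norm] using hf
  have h1 := (ContinuousMap.toLp (E := ℂ) 2 (torusMeasure d) ℂ).hasSum hs.hasSum
  have h2 : HasSum (fun n => f n • char n) (ContinuousMap.toLp (E := ℂ) 2 (torusMeasure d) ℂ
      (∑' n, f n • UnitAddTorus.mFourier (d := Fin d) (-n))) := by
    simpa [Function.comp_def, char] using h1
  rw [(hasSum_fourierTransform f).unique h2]
  filter_upwards [ContinuousMap.coeFn_toLp (𝕜 := ℂ) (p := 2) (torusMeasure d)
    (∑' n, f n • UnitAddTorus.mFourier (d := Fin d) (-n))] with α hα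
  rw [hα, ← ContinuousMap.tsum_apply hs]
  simp

/-- `q_j = lcm {1, 2, …, 2^j}`. -/
def qLcm (j : ℕ) : ℕ := (Finset.Icc 1 (2 ^ j)).lcm id

/-- `Ω_{j,k} ⊆ 𝕋^d`, the image of `[-2^(j-k), 2^(j-k)]^d + (q_j⁻¹ ℤ)^d`. -/
def Omega (d j k : ℕ) : Set (UnitAddTorus (Fin d)) :=
  {α | ∃ (β : Fin d → ℝ) (l : Fin d → ℤ),
    (∀ i, |β i| ≤ (2 : ℝ) ^ ((j : ℤ) - (k : ℤ))) ∧
    ∀ i, α i = ((β i + (l i : ℝ) / (qLcm j : ℝ) : ℝ) : UnitAddCircle)}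

end DiscreteSpherical

end

noncomputable section

namespace DiscreteSpherical

theorem norm_sq_quadratic_gauss_sum_le (q : ℕ) [NeZero q] (a n : ZMod q) (ha : IsUnit a) :
    ‖∑ r : ZMod q, ZMod.stdAddChar (a * r ^ 2 + n * r)‖ ^ 2 ≤ 2 * q := by
  classical
  set ψ : AddChar (ZMod q) ℂ := ZMod.stdAddChar with hψ
  have hnorm : ∀ x, ‖ψ x‖ = 1 := fun x => AddChar.norm_apply ψ x
  have hconj : ∀ x, (starRingEnd ℂ) (ψ x) = ψ (-x) := fun x => (AddChar.map_neg_eq_conj ψ x).symm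
  have key : (((‖∑ r : ZMod q, ψ (a * r ^ 2 + n * r)‖ ^ 2 : ℝ)) : ℂ) =
      ∑ h : ZMod q, ψ (a * h ^ 2 + n * h) * (if 2 * a * h = 0 then (q : ℂ) else 0) := by
    rw [← Complex.normSq_eq_norm_sq, ← Complex.mul_conj, map_sum, Finset.sum_mul_sum,
      Finset.sum_comm]
    simp_rw [hconj, ← AddChar.map_add_eq_mul]
    have : ∀ s : ZMod q, ∑ r : ZMod q, ψ (a * r ^ 2 + n * r + -(a * s ^ 2 + n * s)) =
        ∑ h : ZMod q, ψ (a * h ^ 2 + n * h) * ψ (s * (2 * a * h)) := by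
      intro s
      rw [← Equiv.sum_comp (Equiv.addRight s)]
      refine Finset.sum_congr rfl fun h _ => ?_
      rw [← AddChar.map_add_eq_mul]
      congr 1
      simp only [Equiv.coe_addRight]
      ring
    simp_rw [this]
    rw [Finset.sum_comm]
    refine Finset.sum_congr rfl fun h _ => ?_
    rw [← Finset.mul_sum, AddChar.sum_mulShift _ (ZMod.isPrimitive_stdAddChar q), ZMod.card]
    push_cast
    rfl
  have hcard : (Finset.univ.filter fun h : ZMod q => 2 * a * h = 0).card ≤ 2 := by
    have hsub : (Finset.univ.filter fun h : ZMod q => 2 * a * h = 0) ⊆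
        {0, ((q / 2 : ℕ) : ZMod q)} := by
      intro h hh
      simp only [Finset.mem_filter, Finset.mem_univ, true_and] at hh
      have h2 : 2 * h = 0 := by
        have : a * (2 * h) = 0 := by rw [← hh]; ring
        exact (ha.mul_right_eq_zero).1 this
      have h3 : ((2 * h.val : ℕ) : ZMod q) = 0 := by
        push_cast
        rw [ZMod.natCast_zmod_val, h2]
      rw [ZMod.natCast_eq_zero_iff] at h3
      have hlt := ZMod.val_lt h
      obtain ⟨c, hc⟩ := h3
      have hc2 : c < 2 := by
        by_contra hcon
        push Not at hcon
        nlinarith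
      simp only [Finset.mem_insert, Finset.mem_singleton]
      interval_cases c
      · left
        have : h.val = 0 := by omega
        rwa [ZMod.val_eq_zero] at this
      · right
        have : h.val = q / 2 := by omega
        rw [← this, ZMod.natCast_zmod_val]
    exact (Finset.card_le_card hsub).trans Finset.card_le_two
  have hle : ‖(((‖∑ r : ZMod q, ψ (a * r ^ 2 + n * r)‖ ^ 2 : ℝ)) : ℂ)‖ ≤ 2 * q := by
    rw [key]
    calc _ ≤ ∑ h : ZMod q, ‖ψ (a * h ^ 2 + n * h) * (if 2 * a * h = 0 then (q : ℂ) else 0)‖ :=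
          norm_sum_le _ _
      _ = ∑ h : ZMod q, if 2 * a * h = 0 then (q : ℝ) else 0 := by
          refine Finset.sum_congr rfl fun h _ => ?_
          rw [norm_mul, hnorm]
          split_ifs <;> simp
      _ = (Finset.univ.filter fun h : ZMod q => 2 * a * h = 0).card * q := by
          rw [← Finset.sum_filter, Finset.sum_const, nsmul_eq_mul]
      _ ≤ 2 * q := by
          gcongr
          exact_mod_cast hcard
  rwa [Complex.norm_real, Real.norm_of_nonneg (by positivity)] at hle

/-- The one-dimensional theta series `∑ exp (-2π (ε - i t) m² - 2π i m β)`. -/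
def theta (ε t β : ℝ) : ℂ :=
  ∑' m : ℤ, Complex.exp (-2 * Real.pi * (ε - Complex.I * t) * m ^ 2 - 2 * Real.pi * Complex.I * m * β)

theorem norm_theta_term (ε t β : ℝ) (m : ℤ) :
    ‖Complex.exp (-2 * Real.pi * (ε - Complex.I * t) * m ^ 2 - 2 * Real.pi * Complex.I * m * β)‖ =
      Real.exp (-2 * Real.pi * ε * m ^ 2) := by
  rw [Complex.norm_exp]
  congr 1
  have : (-2 * Real.pi * (ε - Complex.I * t) * m ^ 2 - 2 * Real.pi * Complex.I * m * β : ℂ) =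
      ((-2 * Real.pi * ε * m ^ 2 : ℝ) : ℂ) +
        ((2 * Real.pi * t * m ^ 2 - 2 * Real.pi * m * β : ℝ) : ℂ) * Complex.I := by
    push_cast
    ring
  rw [this, Complex.add_re, Complex.ofReal_re, Complex.re_ofReal_mul, Complex.I_re]
  ring

theorem summable_exp_neg_mul_sq {c : ℝ} (hc : 0 < c) :
    Summable fun m : ℤ => Real.exp (-c * (m : ℝ) ^ 2) := by
  have hN : Summable fun n : ℕ => Real.exp (-c * (n : ℝ) ^ 2) := by
    refine Summable.of_nonneg_of_le (fun _ => by positivity) (fun n => ?_)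
      (Real.summable_exp_nat_mul_iff.2 (neg_lt_zero.2 hc))
    refine Real.exp_le_exp.2 ?_
    have : (n : ℝ) ≤ (n : ℝ) ^ 2 := by exact_mod_cast Nat.le_self_pow two_ne_zero n
    nlinarith
  refine Summable.of_nat_of_neg ?_ ?_
  · simpa using hN
  · simpa using hN

theorem summable_exp_neg_mul_add_sq {c : ℝ} (hc : 0 < c) (x : ℝ) :
    (Summable fun l : ℤ => Real.exp (-c * (x + l) ^ 2)) ∧
    ∑' l : ℤ, Real.exp (-c * (x + l) ^ 2) ≤ ∑' l : ℤ, Real.exp (-(c / 4) * (l : ℝ) ^ 2) := by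
  have hs := summable_exp_neg_mul_sq (c := c / 4) (by positivity)
  set e : ℤ ≃ ℤ := Equiv.subRight (round x) with he
  have hle : ∀ l : ℤ, Real.exp (-c * (x + e l) ^ 2) ≤ Real.exp (-(c / 4) * (l : ℝ) ^ 2) := by
    intro l
    refine Real.exp_le_exp.2 ?_
    have h1 : |x - round x| ≤ 1 / 2 := abs_sub_round x
    set f := x - round x with hf
    have h2 : x + (e l : ℝ) = f + l := by
      simp only [he, Equiv.subRight_apply, Int.cast_sub]
      ring
    rw [h2]
    have h3 : (l : ℝ) ^ 2 / 4 ≤ (f + l) ^ 2 := by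
      have h5 : (|(l : ℝ)| / 2) ^ 2 ≤ |f + l| ^ 2 := by
        rcases eq_or_ne l 0 with h0 | h0
        · subst h0
          simp
          positivity
        · have h4 : (1 : ℝ) ≤ |(l : ℝ)| := by exact_mod_cast Int.one_le_abs h0
          have h6 : |(l : ℝ)| ≤ |f + l| + |f| := by
            calc |(l : ℝ)| = |(f + l) - f| := by ring_nf
              _ ≤ _ := abs_sub _ _
          refine pow_le_pow_left₀ (by positivity) ?_ 2
          linarith
      rw [sq_abs, div_pow, sq_abs] at h5
      linarith
    nlinarith
  have hsum : Summable fun l : ℤ => Real.exp (-c * (x + e l) ^ 2) :=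
    Summable.of_nonneg_of_le (fun _ => by positivity) hle hs
  refine ⟨e.summable_iff.1 hsum, ?_⟩
  rw [← e.tsum_eq]
  exact hsum.tsum_le_tsum hle hs

theorem theta_summand_mod (ε t β τ : ℝ) (q : ℕ) [NeZero q] (a : ℤ) (ht : t = a / q + τ)
    (u r : ℤ) :
    Complex.exp (-2 * Real.pi * (ε - Complex.I * t) * ((u * q + r : ℤ) : ℂ) ^ 2 -
        2 * Real.pi * Complex.I * ((u * q + r : ℤ) : ℂ) * β) =
      ZMod.stdAddChar ((a : ZMod q) * (r : ZMod q) ^ 2) *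
        Complex.exp (-2 * Real.pi * (ε - Complex.I * τ) * r ^ 2 - 2 * Real.pi * Complex.I * r * β) *
        Complex.exp (-Real.pi * (2 * (ε - Complex.I * τ) * q ^ 2) * u ^ 2 +
          2 * Real.pi * (-2 * (ε - Complex.I * τ) * q * r - Complex.I * q * β) * u) := by
  have hq : (q : ℂ) ≠ 0 := by exact_mod_cast NeZero.ne q
  have h1 : (a : ZMod q) * (r : ZMod q) ^ 2 = ((a * (u * q + r) ^ 2 : ℤ) : ZMod q) := by
    push_cast
    simp
  rw [h1, ZMod.stdAddChar_coe, ← Complex.exp_add, ← Complex.exp_add, ht]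
  congr 1
  push_cast
  field_simp
  ring

theorem gaussian_dual_summand (ε β τ : ℝ) (hε : 0 < ε) (q : ℕ) [NeZero q] (n r : ℤ) :
    Complex.exp (-2 * Real.pi * (ε - Complex.I * τ) * r ^ 2 - 2 * Real.pi * Complex.I * r * β) *
      Complex.exp (-Real.pi / (2 * (ε - Complex.I * τ) * q ^ 2) *
        (n + Complex.I * (-2 * (ε - Complex.I * τ) * q * r - Complex.I * q * β)) ^ 2) =
      Complex.exp (-Real.pi / (2 * (ε - Complex.I * τ) * q ^ 2) * (n + q * β) ^ 2) *
        ZMod.stdAddChar ((n : ZMod q) * (r : ZMod q)) := by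
  have hq : (q : ℂ) ≠ 0 := by exact_mod_cast NeZero.ne q
  have hz : (ε - Complex.I * τ : ℂ) ≠ 0 := by
    intro h
    have := congrArg Complex.re h
    simp at this
    exact hε.ne' this
  have h1 : (n : ZMod q) * (r : ZMod q) = ((n * r : ℤ) : ZMod q) := by push_cast; rfl
  rw [h1, ZMod.stdAddChar_coe, ← Complex.exp_add, ← Complex.exp_add]
  congr 1
  have hb : (n + Complex.I * (-2 * (ε - Complex.I * τ) * q * r - Complex.I * q * β) : ℂ) =
      (n + q * β) - 2 * Complex.I * (ε - Complex.I * τ) * q * r := by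
    linear_combination (-(q : ℂ) * β) * Complex.I_sq
  rw [hb]
  generalize (ε - Complex.I * τ : ℂ) = z at hz ⊢
  push_cast
  field_simp
  linear_combination (-4 * q ^ 2 * z ^ 2 * r ^ 2) * Complex.I_sq

theorem summable_norm_theta (ε t β : ℝ) (hε : 0 < ε) :
    Summable fun m : ℤ => ‖Complex.exp
      (-2 * Real.pi * (ε - Complex.I * t) * m ^ 2 - 2 * Real.pi * Complex.I * m * β)‖ := by
  simp_rw [norm_theta_term]
  convert summable_exp_neg_mul_sq (c := 2 * Real.pi * ε) (by positivity) using 3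
  ring

theorem norm_gaussian_dual (ε β τ : ℝ) (hε : 0 < ε) (q : ℕ) [NeZero q] (n : ℤ) :
    ‖Complex.exp (-Real.pi / (2 * (ε - Complex.I * τ) * q ^ 2) * (n + q * β) ^ 2)‖ =
      Real.exp (-(Real.pi / 2 * (ε / (ε ^ 2 + τ ^ 2) / q ^ 2)) * (q * β + n) ^ 2) := by
  have hq : (q : ℝ) ≠ 0 := by exact_mod_cast NeZero.ne q
  have hq' : (q : ℂ) ≠ 0 := by exact_mod_cast NeZero.ne q
  have hn : (0 : ℝ) < ε ^ 2 + τ ^ 2 := by positivity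
  have hz : (ε - Complex.I * τ : ℂ) ≠ 0 := by
    intro h
    have := congrArg Complex.re h
    simp at this
    exact hε.ne' this
  rw [Complex.norm_exp]
  congr 1
  have : (-Real.pi / (2 * (ε - Complex.I * τ) * q ^ 2) * (n + q * β) ^ 2 : ℂ) =
      ((-(Real.pi / 2 * (ε / (ε ^ 2 + τ ^ 2) / q ^ 2)) * (q * β + n) ^ 2 : ℝ) : ℂ) +
      ((-(Real.pi / 2 * (τ / (ε ^ 2 + τ ^ 2) / q ^ 2)) * (q * β + n) ^ 2 : ℝ) : ℂ) * Complex.I := by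
    have hn' : (ε ^ 2 + τ ^ 2 : ℂ) ≠ 0 := by exact_mod_cast hn.ne'
    push_cast
    field_simp
    linear_combination (-((n : ℂ) + q * β) ^ 2 * (τ : ℂ) ^ 2) * Complex.I_sq
  rw [this, Complex.add_re, Complex.ofReal_re, Complex.re_ofReal_mul, Complex.I_re]
  ring

theorem theta_eq (ε t β τ : ℝ) (hε : 0 < ε) (q : ℕ) [NeZero q] (a : ℤ) (ht : t = a / q + τ) :
    theta ε t β = 1 / (2 * (ε - Complex.I * τ) * q ^ 2 : ℂ) ^ (1 / 2 : ℂ) *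
      ∑' n : ℤ, Complex.exp (-Real.pi / (2 * (ε - Complex.I * τ) * q ^ 2) * (n + q * β) ^ 2) *
        ∑ r : ZMod q, ZMod.stdAddChar ((a : ZMod q) * r ^ 2 + (n : ZMod q) * r) := by
  have hq : (0 : ℝ) < q := by exact_mod_cast Nat.pos_of_ne_zero (NeZero.ne q)
  have hA : 0 < (2 * (ε - Complex.I * τ) * q ^ 2 : ℂ).re := by
    have : (2 * (ε - Complex.I * τ) * q ^ 2 : ℂ) =
        ((2 * ε * q ^ 2 : ℝ) : ℂ) + ((-2 * τ * q ^ 2 : ℝ) : ℂ) * Complex.I := by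
      push_cast; ring
    rw [this, Complex.add_re, Complex.ofReal_re, Complex.re_ofReal_mul, Complex.I_re]
    simp
    positivity
  have hbij : Function.Bijective fun r : Fin q => ((r : ℕ) : ZMod q) := by
    rw [Fintype.bijective_iff_injective_and_card]
    refine ⟨fun r s h => ?_, by simp⟩
    simp only [ZMod.natCast_eq_natCast_iff'] at h
    rw [Nat.mod_eq_of_lt r.2, Nat.mod_eq_of_lt s.2] at h
    exact Fin.ext h
  have hs := (summable_norm_theta ε t β hε).of_norm
  have hdual : Summable fun n : ℤ =>
      Complex.exp (-Real.pi / (2 * (ε - Complex.I * τ) * q ^ 2) * (n + q * β) ^ 2) := by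
    refine Summable.of_norm ?_
    simp_rw [norm_gaussian_dual ε β τ hε q]
    exact (summable_exp_neg_mul_add_sq (by positivity) _).1
  have h1 : theta ε t β = ∑ r : Fin q, ∑' u : ℤ, Complex.exp
      (-2 * Real.pi * (ε - Complex.I * t) * ((u * q + ((r : ℕ) : ℤ) : ℤ) : ℂ) ^ 2 -
        2 * Real.pi * Complex.I * ((u * q + ((r : ℕ) : ℤ) : ℤ) : ℂ) * β) := by
    unfold theta
    set e : Fin q × ℤ ≃ ℤ := (Equiv.prodComm _ _).trans (Int.divModEquiv q).symm
    have h := (e.summable_iff.2 hs).tsum_prod.trans (tsum_fintype _)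
    rw [← e.tsum_eq]
    exact h
  have h2 : ∀ r : Fin q, ∑' u : ℤ, Complex.exp
      (-2 * Real.pi * (ε - Complex.I * t) * ((u * q + ((r : ℕ) : ℤ) : ℤ) : ℂ) ^ 2 -
        2 * Real.pi * Complex.I * ((u * q + ((r : ℕ) : ℤ) : ℤ) : ℂ) * β) =
      1 / (2 * (ε - Complex.I * τ) * q ^ 2 : ℂ) ^ (1 / 2 : ℂ) *
      ∑' n : ℤ, Complex.exp (-Real.pi / (2 * (ε - Complex.I * τ) * q ^ 2) * (n + q * β) ^ 2) *
        ZMod.stdAddChar ((a : ZMod q) * ((r : ℕ) : ZMod q) ^ 2 +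
          (n : ZMod q) * ((r : ℕ) : ZMod q)) := by
    intro r
    simp_rw [theta_summand_mod ε t β τ q a ht]
    rw [tsum_mul_left, Complex.tsum_exp_neg_quadratic hA, mul_left_comm, ← tsum_mul_left]
    congr 1
    refine tsum_congr fun n => ?_
    rw [mul_assoc, gaussian_dual_summand ε β τ hε q, AddChar.map_add_eq_mul]
    simp only [Int.cast_natCast]
    ring
  rw [h1, Finset.sum_congr rfl fun r _ => h2 r, ← Finset.mul_sum]
  congr 1
  rw [← Summable.tsum_finsetSum]
  · refine tsum_congr fun n => ?_
    rw [← Finset.mul_sum, ← (Equiv.ofBijective _ hbij).sum_comp]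
    rfl
  · intro r _
    refine Summable.of_norm ?_
    simp_rw [norm_mul, AddChar.norm_apply, mul_one]
    exact hdual.norm

theorem norm_sq_theta_le : ∃ C : ℝ, 0 < C ∧ ∀ (ε t β τ D : ℝ) (q : ℕ) (a : ℤ), 0 < ε → 0 < q →
    IsCoprime a (q : ℤ) → t = a / q + τ → (q : ℝ) ^ 2 * (ε ^ 2 + τ ^ 2) ≤ 2 * ε → 0 ≤ D →
    (∀ l : ℤ, D ≤ |β + l / q|) →
    ‖theta ε t β‖ ^ 2 ≤ C * ((q : ℝ) ^ 2 * (ε ^ 2 + τ ^ 2)) ^ (-(1 / 2) : ℝ) *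
      Real.exp (-(ε * D ^ 2 / (ε ^ 2 + τ ^ 2))) := by
  set S : ℝ := ∑' l : ℤ, Real.exp (-(Real.pi / 8 / 4) * (l : ℝ) ^ 2) with hS
  have hSpos : 0 < S := by
    have hs := summable_exp_neg_mul_sq (c := Real.pi / 8 / 4) (by positivity)
    exact hs.tsum_pos (fun _ => by positivity) 0 (by positivity)
  refine ⟨S ^ 2, by positivity, ?_⟩
  intro ε t β τ D q a hε hq0 ha ht hκ hD hDl
  have : NeZero q := ⟨hq0.ne'⟩
  have hq : (0 : ℝ) < q := by exact_mod_cast hq0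
  have hn : (0 : ℝ) < ε ^ 2 + τ ^ 2 := by positivity
  set κ : ℝ := ε / (ε ^ 2 + τ ^ 2) with hκdef
  have hκpos : 0 < κ := by positivity
  have hκq : 1 / 2 ≤ κ / q ^ 2 := by
    rw [hκdef, div_div, div_le_div_iff₀ (by norm_num) (by positivity)]
    linarith
  have haunit : IsUnit (a : ZMod q) := (ZMod.coe_int_isUnit_iff_isCoprime a q).2 ha.symm
  have hgauss : ∀ n : ℤ, ‖∑ r : ZMod q, ZMod.stdAddChar ((a : ZMod q) * r ^ 2 + (n : ZMod q) * r)‖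
      ≤ Real.sqrt (2 * q) := fun n =>
    Real.le_sqrt_of_sq_le (norm_sq_quadratic_gauss_sum_le q _ _ haunit)
  have hterm : ∀ n : ℤ, ‖Complex.exp (-Real.pi / (2 * (ε - Complex.I * τ) * q ^ 2) * (n + q * β) ^ 2) *
        ∑ r : ZMod q, ZMod.stdAddChar ((a : ZMod q) * r ^ 2 + (n : ZMod q) * r)‖ ≤
      Real.sqrt (2 * q) * Real.exp (-(κ * D ^ 2) / 2) *
        Real.exp (-(Real.pi / 8) * (q * β + n) ^ 2) := by
    intro n
    rw [norm_mul, norm_gaussian_dual ε β τ hε q, mul_comm, mul_assoc, ← Real.exp_add]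
    refine mul_le_mul (hgauss n) (Real.exp_le_exp.2 ?_) (by positivity) (by positivity)
    have h1 : (q * D) ^ 2 ≤ (q * β + n) ^ 2 := by
      have : q * D ≤ |q * β + n| := by
        have h := mul_le_mul_of_nonneg_left (hDl n) hq.le
        rw [← abs_of_pos hq, ← abs_mul, abs_of_pos hq] at h
        have h' : (q : ℝ) * (β + n / q) = q * β + n := by
          field_simp
        rwa [h'] at h
      rw [← sq_abs (q * β + n : ℝ)]
      exact pow_le_pow_left₀ (by positivity) this 2
    have h2 : κ * D ^ 2 ≤ κ / q ^ 2 * (q * β + n) ^ 2 := by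
      calc κ * D ^ 2 = κ / q ^ 2 * (q * D) ^ 2 := by field_simp
        _ ≤ _ := by gcongr
    have h3 : 1 / 2 * (q * β + n) ^ 2 ≤ κ / q ^ 2 * (q * β + n) ^ 2 := by gcongr
    have hpi := Real.pi_gt_three
    have h4 : 0 ≤ κ * D ^ 2 := by positivity
    rw [← hκdef]
    nlinarith [mul_le_mul_of_nonneg_left h2 (by positivity : (0:ℝ) ≤ Real.pi / 4),
      mul_le_mul_of_nonneg_left h3 (by positivity : (0:ℝ) ≤ Real.pi / 4)]
  obtain ⟨hs1, hs2⟩ := summable_exp_neg_mul_add_sq (c := Real.pi / 8) (by positivity) (q * β)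
  have hsum : ‖∑' n : ℤ, Complex.exp (-Real.pi / (2 * (ε - Complex.I * τ) * q ^ 2) * (n + q * β) ^ 2) *
        ∑ r : ZMod q, ZMod.stdAddChar ((a : ZMod q) * r ^ 2 + (n : ZMod q) * r)‖ ≤
      Real.sqrt (2 * q) * Real.exp (-(κ * D ^ 2) / 2) * S := by
    refine (tsum_of_norm_bounded (hs1.mul_left _).hasSum hterm).trans ?_
    rw [tsum_mul_left]
    gcongr
  have hA : ‖(1 / (2 * (ε - Complex.I * τ) * q ^ 2 : ℂ) ^ (1 / 2 : ℂ))‖ ^ 2 =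
      (2 * Real.sqrt (ε ^ 2 + τ ^ 2) * q ^ 2)⁻¹ := by
    have hnorm : ‖(2 * (ε - Complex.I * τ) * q ^ 2 : ℂ)‖ = 2 * Real.sqrt (ε ^ 2 + τ ^ 2) * q ^ 2 := by
      rw [norm_mul, norm_mul, norm_pow, Complex.norm_natCast]
      congr 2
      · simp
      · rw [Complex.norm_eq_sqrt_sq_add_sq]
        congr 1
        simp
    have hne : (2 * (ε - Complex.I * τ) * q ^ 2 : ℂ) ≠ 0 := by
      rw [← norm_ne_zero_iff, hnorm]; positivity
    rw [norm_div, norm_one, div_pow, one_pow, ← norm_pow, ← Complex.cpow_nat_mul]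
    have : ((2 : ℕ) : ℂ) * (1 / 2) = 1 := by norm_num
    rw [this, Complex.cpow_one, hnorm, one_div]
  rw [theta_eq ε t β τ hε q a ht, norm_mul, mul_pow, hA]
  have hfin : (2 * Real.sqrt (ε ^ 2 + τ ^ 2) * q ^ 2)⁻¹ *
      (Real.sqrt (2 * q) * Real.exp (-(κ * D ^ 2) / 2) * S) ^ 2 =
      S ^ 2 * ((q : ℝ) ^ 2 * (ε ^ 2 + τ ^ 2)) ^ (-(1 / 2) : ℝ) *
      Real.exp (-(ε * D ^ 2 / (ε ^ 2 + τ ^ 2))) := by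
    rw [mul_pow, mul_pow, Real.sq_sqrt (by positivity), ← Real.exp_nat_mul, Real.rpow_neg (by positivity),
      ← Real.sqrt_eq_rpow, Real.sqrt_mul (by positivity), Real.sqrt_sq hq.le]
    have : ((2 : ℕ) : ℝ) * (-(κ * D ^ 2) / 2) = -(ε * D ^ 2 / (ε ^ 2 + τ ^ 2)) := by
      rw [hκdef]; push_cast; ring
    rw [this]
    field_simp
  rw [← hfin]
  gcongr

theorem exists_sq_add_sq_eq_neg_one_of_prime_pow {p : ℕ} (hp : p.Prime) (hp2 : p ≠ 2) (k : ℕ) :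
    ∃ a b : ℤ, (p : ℤ) ^ (k + 1) ∣ a ^ 2 + b ^ 2 + 1 ∧ ¬ (p : ℤ) ∣ a := by
  induction k with
  | zero =>
    have : Fact p.Prime := ⟨hp⟩
    obtain ⟨a, b, hab⟩ := ZMod.sq_add_sq p (-1)
    have key : ∀ a b : ZMod p, a ^ 2 + b ^ 2 = -1 → a ≠ 0 →
        ∃ a b : ℤ, (p : ℤ) ^ (0 + 1) ∣ a ^ 2 + b ^ 2 + 1 ∧ ¬ (p : ℤ) ∣ a := by
      intro a b hab ha
      refine ⟨a.val, b.val, ?_, ?_⟩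
      · rw [zero_add, pow_one, ← ZMod.intCast_zmod_eq_zero_iff_dvd]
        push_cast
        simp [hab]
      · rw [← ZMod.intCast_zmod_eq_zero_iff_dvd]
        simpa using ha
    by_cases ha : a = 0
    · refine key b a (by rw [add_comm, hab]) ?_
      rintro rfl
      subst ha
      simp at hab
    · exact key a b hab ha
  | succ k ih =>
    obtain ⟨a, b, ⟨m, hm⟩, ha⟩ := ih
    have hpr : Prime (p : ℤ) := Nat.prime_iff_prime_int.1 hp
    have h2a : ¬ (p : ℤ) ∣ 2 * a := by
      intro h
      rcases hpr.dvd_or_dvd h with h | h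
      · have : p ∣ 2 := by exact_mod_cast h
        exact hp2 ((Nat.prime_dvd_prime_iff_eq hp Nat.prime_two).1 this)
      · exact ha h
    obtain ⟨u, v, huv⟩ := (hpr.irreducible.coprime_iff_not_dvd).2 h2a
    refine ⟨a + (p : ℤ) ^ (k + 1) * (-m * v), b, ?_, ?_⟩
    · have : (a + (p : ℤ) ^ (k + 1) * (-m * v)) ^ 2 + b ^ 2 + 1 =
          (p : ℤ) ^ (k + 1 + 1) * (m * u + p ^ k * (m * v) ^ 2) := by
        have h1 : (a + (p : ℤ) ^ (k + 1) * (-m * v)) ^ 2 + b ^ 2 + 1 =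
          (a ^ 2 + b ^ 2 + 1) - (p : ℤ) ^ (k + 1) * m * (v * (2 * a)) +
            (p : ℤ) ^ (k + 1) * p ^ (k + 1) * (m * v) ^ 2 := by ring
        rw [h1, hm, eq_sub_of_add_eq' huv]
        ring
      exact ⟨_, this⟩
    · intro h
      refine ha ((Int.dvd_add_left ?_).1 h)
      exact Dvd.dvd.mul_right (dvd_pow_self _ (Nat.succ_ne_zero k)) _

theorem exists_sq_add_sq_eq_neg_one {n : ℕ} (hn : Odd n) : ∃ a b : ZMod n, a ^ 2 + b ^ 2 = -1 := by
  induction n using Nat.recOnPosPrimePosCoprime with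
  | zero => simp at hn
  | one => exact ⟨0, 0, Subsingleton.elim _ _⟩
  | prime_pow p k hp hk =>
    obtain ⟨k, rfl⟩ := Nat.exists_eq_succ_of_ne_zero hk.ne'
    have hp2 : p ≠ 2 := by
      rintro rfl
      exact (Nat.not_odd_iff_even.2 ((even_two).pow_of_ne_zero (Nat.succ_ne_zero k))) hn
    obtain ⟨a, b, h, -⟩ := exists_sq_add_sq_eq_neg_one_of_prime_pow hp hp2 k
    refine ⟨a, b, ?_⟩
    have : (((a ^ 2 + b ^ 2 + 1 : ℤ)) : ZMod (p ^ (k + 1))) = 0 := by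
      rw [ZMod.intCast_zmod_eq_zero_iff_dvd]
      exact_mod_cast h
    push_cast at this
    exact eq_neg_of_add_eq_zero_left this
  | coprime m n _ _ hmn ihm ihn =>
    rw [Nat.odd_mul] at hn
    obtain ⟨a, b, h1⟩ := ihm hn.1
    obtain ⟨c, d, h2⟩ := ihn hn.2
    set e := ZMod.chineseRemainder hmn
    refine ⟨e.symm (a, c), e.symm (b, d), e.injective ?_⟩
    simp [Prod.ext_iff, h1, h2]

theorem volume_sum_sq_lt (r : ℝ) (hr : 0 ≤ r) :
    volume {x : Fin 4 → ℝ | ∑ i, x i ^ 2 < r} = ENNReal.ofReal (Real.pi ^ 2 / 2 * r ^ 2) := by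
  have h := (EuclideanSpace.volume_preserving_symm_measurableEquiv_toLp (Fin 4)).measure_preimage
    (s := {x : Fin 4 → ℝ | ∑ i, x i ^ 2 < r})
    (measurableSet_lt (by fun_prop) measurable_const).nullMeasurableSet
  have hball : (MeasurableEquiv.toLp 2 (Fin 4 → ℝ)).symm ⁻¹' {x : Fin 4 → ℝ | ∑ i, x i ^ 2 < r} =
      Metric.ball (0 : EuclideanSpace ℝ (Fin 4)) (Real.sqrt r) := by
    ext x
    simp only [Set.mem_preimage, Set.mem_ofPred_eq, mem_ball_zero_iff, EuclideanSpace.norm_eq,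
      Real.norm_eq_abs, sq_abs]
    rw [Real.sqrt_lt_sqrt_iff (by positivity)]
    rfl
  have hG : Real.Gamma ((4 : ℝ) / 2 + 1) = 2 := by
    have := Real.Gamma_nat_eq_factorial 2
    norm_num at this ⊢
  rw [← h, hball, EuclideanSpace.volume_ball, ← ENNReal.ofReal_pow (by positivity),
    ← ENNReal.ofReal_mul (by positivity), Fintype.card_fin]
  congr 1
  push_cast
  rw [hG]
  have h1 : Real.sqrt r ^ 4 = r ^ 2 := by
    rw [show 4 = 2 * 2 from rfl, pow_mul, Real.sq_sqrt hr]
  have h2 : Real.sqrt Real.pi ^ 4 = Real.pi ^ 2 := by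
    rw [show 4 = 2 * 2 from rfl, pow_mul, Real.sq_sqrt Real.pi_nonneg]
  rw [h1, h2]
  ring

theorem convex_sum_sq_lt (r : ℝ) : Convex ℝ {x : Fin 4 → ℝ | ∑ i, x i ^ 2 < r} := by
  have h : ConvexOn ℝ Set.univ fun x : Fin 4 → ℝ => ∑ i, x i ^ 2 := by
    refine ⟨convex_univ, fun x _ y _ a b ha hb hab => ?_⟩
    simp only [Pi.add_apply, Pi.smul_apply, smul_eq_mul]
    rw [Finset.mul_sum, Finset.mul_sum, ← Finset.sum_add_distrib]
    refine Finset.sum_le_sum fun i _ => ?_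
    have hb' : b = 1 - a := by linarith
    subst hb'
    nlinarith [mul_nonneg (mul_nonneg ha hb) (sq_nonneg (x i - y i))]
  simpa using h.convex_lt r

/-- Minkowski's theorem for sublattices of `ℤ⁴` that are kernels of homomorphisms. -/
theorem exists_ne_zero_ker_sum_sq_lt {G : Type*} [AddCommGroup G] [Finite G]
    (φ : (Fin 4 → ℤ) →+ G) (n : ℕ) (hn : 0 < n) (hG : Nat.card G ≤ n ^ 2) :
    ∃ v : Fin 4 → ℤ, v ≠ 0 ∧ φ v = 0 ∧ ∑ i, v i ^ 2 < 2 * (n : ℤ) := by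
  classical
  let c : (Fin 4 → ℤ) →+ (Fin 4 → ℝ) :=
    { toFun := fun v i => (v i : ℝ)
      map_zero' := by ext; simp
      map_add' := fun v w => by ext; simp }
  have hc : Function.Injective c := fun v w h => by
    ext i
    have : (v i : ℝ) = w i := congrFun h i
    exact_mod_cast this
  let L₂ : Submodule ℤ (Fin 4 → ℝ) := Submodule.span ℤ (Set.range (Pi.basisFun ℝ (Fin 4)))
  let L₁ : Submodule ℤ (Fin 4 → ℝ) := AddSubgroup.toIntSubmodule (φ.ker.map c)
  have hL₂ : L₂.toAddSubgroup = (⊤ : AddSubgroup (Fin 4 → ℤ)).map c := by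
    ext x
    simp only [L₂, Submodule.mem_toAddSubgroup, Module.Basis.mem_span_iff_repr_mem,
      AddSubgroup.mem_map, AddSubgroup.mem_top, true_and, Pi.basisFun_repr, Set.mem_range]
    constructor
    · intro h
      choose v hv using h
      exact ⟨v, by ext i; simpa [c] using hv i⟩
    · rintro ⟨v, rfl⟩ i
      exact ⟨v i, by simp [c]⟩
  have hle : L₁ ≤ L₂ := by
    intro x hx
    have hx' : x ∈ φ.ker.map c := hx
    have : x ∈ L₂.toAddSubgroup := by
      rw [hL₂]
      exact AddSubgroup.map_mono le_top hx'
    exact this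
  have hd₁ : DiscreteTopology L₁ :=
    DiscreteTopology.of_subset (inferInstanceAs (DiscreteTopology L₂)) hle
  have hz₁ : IsZLattice ℝ L₁ := by
    refine ⟨?_⟩
    rw [eq_top_iff, ← (Pi.basisFun ℝ (Fin 4)).span_eq, Submodule.span_le]
    rintro _ ⟨i, rfl⟩
    have hG0 : (Nat.card G : ℝ) ≠ 0 := by exact_mod_cast Nat.card_pos.ne'
    have hmem : (Nat.card G : ℝ) • (Pi.basisFun ℝ (Fin 4) i) ∈ L₁ := by
      refine ⟨Nat.card G • Pi.single i 1, ?_, ?_⟩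
      · change φ _ = 0
        rw [map_nsmul, card_nsmul_eq_zero']
      · ext l
        simp [c, Pi.single_apply]
    have := Submodule.smul_mem (Submodule.span ℝ (L₁ : Set (Fin 4 → ℝ))) (Nat.card G : ℝ)⁻¹
      (Submodule.subset_span hmem)
    rwa [smul_smul, inv_mul_cancel₀ hG0, one_smul] at this
  have hcov₂ : ZLattice.covolume L₂ = 1 := by
    rw [ZLattice.covolume_eq_measure_fundamentalDomain L₂ volume
      (ZSpan.isAddFundamentalDomain (Pi.basisFun ℝ (Fin 4)) volume), measureReal_def,
      ZSpan.fundamentalDomain_pi_basisFun, volume_pi_pi]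
    simp
  have hcov₁ : ZLattice.covolume L₁ ≤ (n : ℝ) ^ 2 := by
    have h := ZLattice.covolume_div_covolume_eq_relIndex L₁ L₂ hle
    rw [hcov₂, div_one, hL₂] at h
    have h' : L₁.toAddSubgroup = φ.ker.map c := rfl
    rw [h', AddSubgroup.relIndex_map_map_of_injective _ _ hc, AddSubgroup.relIndex_top_right,
      AddSubgroup.index_ker] at h
    rw [h]
    have : Nat.card φ.range ≤ Nat.card G := Nat.card_le_card_of_injective _ Subtype.val_injective
    exact_mod_cast this.trans hG
  let b := IsZLattice.basis L₁
  have hfund := ZLattice.isAddFundamentalDomain b volume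
  have hcovF := ZLattice.covolume_eq_measure_fundamentalDomain L₁ volume hfund
  set F := ZSpan.fundamentalDomain (Module.Basis.ofZLatticeBasis ℝ L₁ b)
  have hFfin : volume F ≠ ∞ := (ZSpan.fundamentalDomain_isBounded _).measure_lt_top.ne
  have hF : volume F ≤ ENNReal.ofReal ((n : ℝ) ^ 2) := by
    rw [← ENNReal.ofReal_toReal hFfin]
    refine ENNReal.ofReal_le_ofReal ?_
    rw [← measureReal_def, ← hcovF]
    exact hcov₁
  have hn' : (0 : ℝ) < n := by exact_mod_cast hn
  have : Countable L₁.toAddSubgroup := inferInstanceAs (Countable L₁)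
  obtain ⟨x, hx0, hx⟩ := exists_ne_zero_mem_lattice_of_measure_mul_two_pow_lt_measure
    (L := L₁.toAddSubgroup) (μ := volume)
    (s := {x : Fin 4 → ℝ | ∑ i, x i ^ 2 < 2 * n}) hfund
    (by intro x hx; simpa using hx) (convex_sum_sq_lt _) (by
      rw [volume_sum_sq_lt _ (by positivity)]
      refine lt_of_le_of_lt (mul_le_mul_left hF _) ?_
      have : (2 : ℝ≥0∞) ^ Module.finrank ℝ (Fin 4 → ℝ) = ENNReal.ofReal 16 := by
        rw [Module.finrank_fin_fun, ← ENNReal.ofReal_ofNat, ← ENNReal.ofReal_pow (by norm_num)]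
        norm_num
      rw [this, ← ENNReal.ofReal_mul (by positivity)]
      refine (ENNReal.ofReal_lt_ofReal_iff (by positivity)).2 ?_
      have := Real.pi_gt_three
      nlinarith [mul_pos hn' hn', mul_pos (mul_pos hn' hn') (by nlinarith : 0 < Real.pi ^ 2 - 9)])
  obtain ⟨x, v, hv, rfl⟩ := x
  refine ⟨v, ?_, hv, ?_⟩
  · rintro rfl
    exact hx0 (Subtype.ext (map_zero c))
  · have : ∑ i, ((v i : ℝ)) ^ 2 < 2 * n := hx
    exact_mod_cast this

theorem mem_sphere_sqrt {d N : ℕ} {m : Fin d → ℤ} :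
    m ∈ sphere d (Real.sqrt N) ↔ ∑ i, m i ^ 2 = (N : ℤ) := by
  rw [sphere, Set.Finite.mem_toFinset]
  change Real.sqrt _ = _ ↔ _
  rw [Real.sqrt_inj (by positivity) (by positivity)]
  exact_mod_cast Iff.rfl

/-- The integral matrix entries of the quaternion `v` in a splitting modulo `n`, combined into the
two congruences saying that `(t, 1)` lies in the kernel of the matrix. -/
def splitKernelHom (n : ℕ) (a b t : ℤ) : (Fin 4 → ℤ) →+ ZMod n × ZMod n where
  toFun v := (((-v 1 + b * v 2 + a * v 3 + t * (v 0 + a * v 2 - b * v 3) : ℤ) : ZMod n),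
    ((v 0 - a * v 2 + b * v 3 + t * (v 1 + b * v 2 + a * v 3) : ℤ) : ZMod n))
  map_zero' := by simp
  map_add' v w := by
    ext
    · simp only [Pi.add_apply, Prod.fst_add]
      push_cast
      ring
    · simp only [Pi.add_apply, Prod.snd_add]
      push_cast
      ring

theorem splitKernelHom_eq_zero_iff {n : ℕ} {a b t : ℤ} {v : Fin 4 → ℤ} :
    splitKernelHom n a b t v = 0 ↔
      (n : ℤ) ∣ -v 1 + b * v 2 + a * v 3 + t * (v 0 + a * v 2 - b * v 3) ∧
      (n : ℤ) ∣ v 0 - a * v 2 + b * v 3 + t * (v 1 + b * v 2 + a * v 3) := by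
  rw [← ZMod.intCast_zmod_eq_zero_iff_dvd, ← ZMod.intCast_zmod_eq_zero_iff_dvd]
  exact Prod.ext_iff

theorem dvd_sum_sq_of_splitKernel {n a b t : ℤ} (hab : n ∣ a ^ 2 + b ^ 2 + 1) {v : Fin 4 → ℤ}
    (h1 : n ∣ -v 1 + b * v 2 + a * v 3 + t * (v 0 + a * v 2 - b * v 3))
    (h2 : n ∣ v 0 - a * v 2 + b * v 3 + t * (v 1 + b * v 2 + a * v 3)) :
    n ∣ ∑ i, v i ^ 2 := by
  obtain ⟨c, hc⟩ := hab
  obtain ⟨x, hx⟩ := h1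
  obtain ⟨y, hy⟩ := h2
  refine ⟨c * (v 2 ^ 2 + v 3 ^ 2) + (v 0 + a * v 2 - b * v 3) * y
    - (v 1 + b * v 2 + a * v 3) * x, ?_⟩
  rw [Fin.sum_univ_four]
  linear_combination (v 2 ^ 2 + v 3 ^ 2) * hc + (v 0 + a * v 2 - b * v 3) * hy
    - (v 1 + b * v 2 + a * v 3) * hx

theorem splitKernel_parameter_unique {n : ℕ} (hn : Odd n) {a b t t' : ℤ}
    (hab : (n : ℤ) ∣ a ^ 2 + b ^ 2 + 1) {v : Fin 4 → ℤ} (hv : ∑ i, v i ^ 2 = (n : ℤ))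
    (h : splitKernelHom n a b t v = 0) (h' : splitKernelHom n a b t' v = 0) :
    (n : ℤ) ∣ t - t' := by
  have hn0 : (n : ℤ) ≠ 0 := by
    have := hn.pos
    exact_mod_cast this.ne'
  rw [splitKernelHom_eq_zero_iff] at h h'
  obtain ⟨h1, h2⟩ := h
  obtain ⟨h1', h2'⟩ := h'
  set δ := t - t' with hδ
  have k1 : (n : ℤ) ∣ δ * (v 0 + a * v 2 - b * v 3) := by
    refine Eq.subst (motive := fun z => (n : ℤ) ∣ z) ?_
        (h1.sub h1')
    rw [hδ]; ring
  have k2 : (n : ℤ) ∣ δ * (v 1 + b * v 2 + a * v 3) := by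
    refine Eq.subst (motive := fun z => (n : ℤ) ∣ z) ?_
        (h2.sub h2')
    rw [hδ]; ring
  have k3 : (n : ℤ) ∣ δ * (-v 1 + b * v 2 + a * v 3) := by
    refine Eq.subst (motive := fun z => (n : ℤ) ∣ z) ?_
        ((h1.mul_left δ).sub (k1.mul_left t))
    ring
  have k4 : (n : ℤ) ∣ δ * (v 0 - a * v 2 + b * v 3) := by
    refine Eq.subst (motive := fun z => (n : ℤ) ∣ z) ?_
        ((h2.mul_left δ).sub (k2.mul_left t))
    ring
  have h2n : IsCoprime (n : ℤ) 2 := by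
    rw [Int.isCoprime_iff_gcd_eq_one]
    exact (Nat.coprime_two_right).2 hn
  have hmain : ∀ i, (n : ℤ) ∣ δ * v i := by
    have j0 : (n : ℤ) ∣ 2 * (δ * v 0) := by
      refine Eq.subst (motive := fun z => (n : ℤ) ∣ z) ?_
        (k1.add k4)
      ring
    have j1 : (n : ℤ) ∣ 2 * (δ * v 1) := by
      refine Eq.subst (motive := fun z => (n : ℤ) ∣ z) ?_
        (k2.sub k3)
      ring
    have j2 : (n : ℤ) ∣ 2 * (δ * v 2) := by
      refine Eq.subst (motive := fun z => (n : ℤ) ∣ z) ?_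
        ((hab.mul_left (2 * δ * v 2)).sub
        (((k1.sub k4).mul_left a).add ((k2.add k3).mul_left b)))
      ring
    have j3 : (n : ℤ) ∣ 2 * (δ * v 3) := by
      refine Eq.subst (motive := fun z => (n : ℤ) ∣ z) ?_
        ((hab.mul_left (2 * δ * v 3)).sub
        (((k2.add k3).mul_left a).sub ((k1.sub k4).mul_left b)))
      ring
    intro i
    refine h2n.dvd_of_dvd_mul_left ?_
    fin_cases i
    · exact j0
    · exact j1
    · exact j2
    · exact j3
  set g : ℤ := ((Int.gcd n δ : ℕ) : ℤ) with hg
  have hg0 : g ≠ 0 := by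
    rw [hg]
    exact_mod_cast (Int.gcd_pos_of_ne_zero_left _ hn0).ne'
  obtain ⟨p, hp⟩ : g ∣ n := Int.gcd_dvd_left _ _
  obtain ⟨e, he⟩ : g ∣ δ := Int.gcd_dvd_right _ _
  have hcop : IsCoprime p e := by
    have hb := Int.gcd_eq_gcd_ab n δ
    rw [← hg] at hb
    refine ⟨Int.gcdA n δ, Int.gcdB n δ, mul_left_cancel₀ hg0 ?_⟩
    linear_combination -hb + (Int.gcdA n δ) * hp.symm + (Int.gcdB n δ) * he.symm
  have hpv : ∀ i, p ∣ v i := by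
    intro i
    have := hmain i
    rw [hp, he, mul_assoc] at this
    exact hcop.dvd_of_dvd_mul_left (Int.dvd_of_mul_dvd_mul_left hg0 this)
  choose u hu using hpv
  have hp0 : p ≠ 0 := by
    rintro rfl
    exact hn0 (by rw [hp, mul_zero])
  have hgn : g ∣ (n : ℤ) := ⟨p, hp⟩
  have hdvd : g ∣ ∑ i, u i ^ 2 := by
    refine dvd_sum_sq_of_splitKernel (a := a) (b := b) (t := t) (hgn.trans hab) ?_ ?_
    · refine Int.dvd_of_mul_dvd_mul_left hp0 ?_
      rw [mul_comm p g, ← hp]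
      convert h1 using 1
      rw [hu 0, hu 1, hu 2, hu 3]
      ring
    · refine Int.dvd_of_mul_dvd_mul_left hp0 ?_
      rw [mul_comm p g, ← hp]
      convert h2 using 1
      rw [hu 0, hu 1, hu 2, hu 3]
      ring
  obtain ⟨s, hs⟩ := hdvd
  have hps : p * (p * s) = p := by
    have h3 : p ^ 2 * ∑ i, u i ^ 2 = n := by
      rw [← hv, Finset.mul_sum]
      refine Finset.sum_congr rfl fun i _ => ?_
      rw [hu i]; ring
    rw [hs] at h3
    refine mul_left_cancel₀ hg0 ?_
    linear_combination h3 + hp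
  have hpunit : p * s = 1 := mul_left_cancel₀ hp0 (by rw [hps, mul_one])
  rw [he, hp]
  refine mul_dvd_mul_left g ?_
  exact (IsUnit.of_mul_eq_one _ hpunit).dvd

theorem le_card_sphere_four {n : ℕ} (hn : Odd n) : n ≤ (sphere 4 (Real.sqrt n)).card := by
  obtain ⟨a', b', hab'⟩ := exists_sq_add_sq_eq_neg_one hn
  have : NeZero n := ⟨hn.pos.ne'⟩
  obtain ⟨a, rfl⟩ := ZMod.intCast_surjective a'
  obtain ⟨b, rfl⟩ := ZMod.intCast_surjective b'
  have hab : (n : ℤ) ∣ a ^ 2 + b ^ 2 + 1 := by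
    rw [← ZMod.intCast_zmod_eq_zero_iff_dvd]
    push_cast
    rw [hab']
    ring
  have hex : ∀ t : ℤ, ∃ v : Fin 4 → ℤ, ∑ i, v i ^ 2 = (n : ℤ) ∧ splitKernelHom n a b t v = 0 := by
    intro t
    obtain ⟨v, hv0, hv, hlt⟩ := exists_ne_zero_ker_sum_sq_lt (splitKernelHom n a b t) n hn.pos
      (by rw [Nat.card_prod, Nat.card_zmod, sq])
    refine ⟨v, ?_, hv⟩
    have h := splitKernelHom_eq_zero_iff.1 hv
    obtain ⟨c, hc⟩ := dvd_sum_sq_of_splitKernel hab h.1 h.2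
    have hpos : 0 < ∑ i, v i ^ 2 := by
      obtain ⟨i, hi⟩ := Function.ne_iff.1 hv0
      exact Finset.sum_pos' (fun _ _ => sq_nonneg _) ⟨i, Finset.mem_univ _, by
        have : v i ≠ 0 := hi
        positivity⟩
    have hn' : (0 : ℤ) < n := by exact_mod_cast hn.pos
    rw [hc] at hpos hlt ⊢
    have h1 : 0 < c := by
      by_contra hcon
      push Not at hcon
      nlinarith
    have h2 : c < 2 := by
      by_contra hcon
      push Not at hcon
      nlinarith
    have : c = 1 := by omega
    rw [this, mul_one]
  choose v hv hk using hex
  have := Finset.card_le_card_of_injOn (s := Finset.range n) (t := sphere 4 (Real.sqrt n))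
    (fun t => v t) (fun t _ => mem_sphere_sqrt.2 (hv t)) (by
      intro t ht s hs hts
      have hts' : v t = v s := hts
      have h2 := hk s
      rw [← hts'] at h2
      have h3 := splitKernel_parameter_unique hn hab (hv t) (hk t) h2
      simp only [Finset.coe_range, Set.mem_Iio] at ht hs
      have h4 := Int.eq_zero_of_abs_lt_dvd h3 (by rw [abs_lt]; constructor <;> omega)
      omega)
  simpa using this

theorem sum_card_sphere_le (d N : ℕ) (S : Finset ℕ) (hS : ∀ m ∈ S, m ^ 2 ≤ N) :
    ∑ m ∈ S, (sphere d (Real.sqrt ((N - m ^ 2 : ℕ) : ℝ))).card ≤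
      (sphere (d + 1) (Real.sqrt N)).card := by
  rw [← Finset.card_sigma]
  refine Finset.card_le_card_of_injOn (fun x => (Fin.cons (x.1 : ℤ) x.2 : Fin (d + 1) → ℤ)) ?_ ?_
  · rintro ⟨m, v⟩ hx
    simp only [Finset.coe_sigma, Set.mem_sigma_iff, Finset.mem_coe] at hx
    have h1 := mem_sphere_sqrt.1 hx.2
    have h2 := hS m hx.1
    rw [Finset.mem_coe, mem_sphere_sqrt, Fin.sum_univ_succ]
    simp only [Fin.cons_zero, Fin.cons_succ]
    rw [h1]
    push_cast [h2]
    ring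
  · rintro ⟨m, v⟩ _ ⟨m', v'⟩ _ h
    have h' : (Fin.cons (m : ℤ) v : Fin (d + 1) → ℤ) = Fin.cons (m' : ℤ) v' := h
    obtain ⟨h1, h2⟩ := Fin.cons_injective2 h'
    have h1' : m = m' := by exact_mod_cast h1
    subst h1'
    rw [h2]

theorem card_sphere_five_ge {N : ℕ} (hN : 1 ≤ N) :
    1 / 64 * (N : ℝ) ^ ((5 : ℝ) / 2 - 1) ≤ (sphere 5 (Real.sqrt N)).card := by
  obtain ⟨e, he, hpar⟩ : ∃ e : ℕ, e ≤ 1 ∧ (N + e) % 2 = 1 := by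
    rcases Nat.even_or_odd N with h | h
    · exact ⟨1, le_rfl, by obtain ⟨r, rfl⟩ := h; omega⟩
    · exact ⟨0, zero_le_one, by obtain ⟨r, rfl⟩ := h; omega⟩
  have hodd : ∀ i : ℕ, (2 * i + e) ^ 2 ≤ N → Odd (N - (2 * i + e) ^ 2) := by
    intro i hi
    rw [Nat.odd_iff]
    have : (2 * i + e) ^ 2 % 2 = e % 2 := by
      rw [Nat.pow_mod, Nat.mul_add_mod]
      interval_cases e <;> norm_num
    omega
  have hpow : (N : ℝ) ^ ((5 : ℝ) / 2 - 1) = N * Real.sqrt N := by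
    have hN0 : (0 : ℝ) < N := by exact_mod_cast hN
    rw [show (5 : ℝ) / 2 - 1 = 1 + 1 / 2 by norm_num, Real.rpow_add hN0, Real.rpow_one,
      Real.sqrt_eq_rpow]
  rw [hpow]
  have hlow : ∀ I : ℕ, (∀ i < I, (2 * i + e) ^ 2 ≤ N) →
      ∑ i ∈ Finset.range I, (N - (2 * i + e) ^ 2) ≤ (sphere 5 (Real.sqrt N)).card := by
    intro I hI
    have h := sum_card_sphere_le 4 N ((Finset.range I).image fun i => 2 * i + e) (by
      intro m hm
      obtain ⟨i, hi, rfl⟩ := Finset.mem_image.1 hm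
      exact hI i (Finset.mem_range.1 hi))
    rw [Finset.sum_image (by intro x _ y _ h; simp only at h; omega)] at h
    refine le_trans (Finset.sum_le_sum fun i hi => ?_) h
    exact le_card_sphere_four (hodd i (hI i (Finset.mem_range.1 hi)))
  have hs0 := Real.sqrt_nonneg (N : ℝ)
  have hsq : Real.sqrt (N : ℝ) ^ 2 = N := Real.sq_sqrt (by positivity)
  rcases lt_or_ge N 16 with h16 | h16
  · have h := hlow 1 (by
      intro i hi
      interval_cases i
      interval_cases e <;> omega)
    have hpos : 1 ≤ ∑ i ∈ Finset.range 1, (N - (2 * i + e) ^ 2) := by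
      rw [Finset.sum_range_one]
      interval_cases e <;> omega
    have h1 : (1 : ℝ) ≤ (sphere 5 (Real.sqrt N)).card := by exact_mod_cast hpos.trans h
    have h2 : (N : ℝ) ≤ 16 := by exact_mod_cast h16.le
    have h3 : Real.sqrt N ≤ 4 := by
      rw [show (4 : ℝ) = Real.sqrt 16 by rw [show (16 : ℝ) = 4 ^ 2 by norm_num]; simp]
      exact Real.sqrt_le_sqrt h2
    nlinarith [mul_le_mul h2 h3 hs0 (by norm_num)]
  · have h4 : 4 ≤ Real.sqrt N := by
      rw [show (4 : ℝ) = Real.sqrt 16 by rw [show (16 : ℝ) = 4 ^ 2 by norm_num]; simp]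
      exact Real.sqrt_le_sqrt (by exact_mod_cast h16)
    set I := ⌊Real.sqrt N / 4⌋₊ + 1 with hI
    have hIlow : Real.sqrt N / 4 ≤ I := by
      rw [hI]
      push_cast
      exact (Nat.lt_floor_add_one _).le
    have hm : ∀ i < I, ((2 * i + e : ℕ) : ℝ) ^ 2 ≤ 9 / 16 * N := by
      intro i hi
      have h5 : (i : ℝ) ≤ Real.sqrt N / 4 := by
        refine le_trans ?_ (Nat.floor_le (by positivity))
        exact_mod_cast Nat.lt_succ_iff.1 hi
      have h6 : (e : ℝ) ≤ 1 := by exact_mod_cast he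
      have h7 : ((2 * i + e : ℕ) : ℝ) ≤ 3 / 4 * Real.sqrt N := by
        push_cast
        linarith
      calc ((2 * i + e : ℕ) : ℝ) ^ 2 ≤ (3 / 4 * Real.sqrt N) ^ 2 := by gcongr
        _ = 9 / 16 * (N : ℝ) := by rw [mul_pow, hsq]; norm_num
    have hm' : ∀ i < I, (2 * i + e) ^ 2 ≤ N := by
      intro i hi
      have := hm i hi
      have h8 : (((2 * i + e) ^ 2 : ℕ) : ℝ) ≤ N := by
        rw [Nat.cast_pow]
        have : (0 : ℝ) ≤ N := by positivity
        linarith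
      exact_mod_cast h8
    have h := hlow I hm'
    have h9 : (I : ℝ) * (7 / 16 * N) ≤ ((∑ i ∈ Finset.range I, (N - (2 * i + e) ^ 2) : ℕ) : ℝ) := by
      rw [Nat.cast_sum]
      calc (I : ℝ) * (7 / 16 * N) = ∑ i ∈ Finset.range I, (7 / 16 * N : ℝ) := by simp
        _ ≤ _ := by
          refine Finset.sum_le_sum fun i hi => ?_
          rw [Nat.cast_sub (hm' i (Finset.mem_range.1 hi)), Nat.cast_pow]
          have := hm i (Finset.mem_range.1 hi)
          linarith
    have h10 : ((∑ i ∈ Finset.range I, (N - (2 * i + e) ^ 2) : ℕ) : ℝ) ≤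
        (sphere 5 (Real.sqrt N)).card := by exact_mod_cast h
    have hN0 : (0 : ℝ) ≤ N := by positivity
    nlinarith [mul_le_mul_of_nonneg_right hIlow hN0, mul_nonneg hN0 hs0]

/-- The lower bound `N_λ ≳ λ^(d-2)` for the number of lattice points on spheres. -/
theorem card_sphere_ge (d : ℕ) (hd : 5 ≤ d) : ∃ c : ℝ, 0 < c ∧ ∀ N : ℕ, 1 ≤ N →
    c * (N : ℝ) ^ ((d : ℝ) / 2 - 1) ≤ (sphere d (Real.sqrt N)).card := by
  induction d, hd using Nat.le_induction with
  | base => exact ⟨1 / 64, by norm_num, fun N hN => by exact_mod_cast card_sphere_five_ge hN⟩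
  | succ d hd ih =>
    obtain ⟨c, hc, hcN⟩ := ih
    have hd' : (5 : ℝ) ≤ d := by exact_mod_cast hd
    refine ⟨c * (3 / 4) ^ ((d : ℝ) / 2 - 1) / 2, by positivity, fun N hN => ?_⟩
    have hN0 : (0 : ℝ) < N := by exact_mod_cast hN
    set I := ⌊Real.sqrt N / 2⌋₊ + 1 with hI
    have hIlow : Real.sqrt N / 2 ≤ I := by
      rw [hI]
      push_cast
      exact (Nat.lt_floor_add_one _).le
    have hm : ∀ i < I, (i : ℝ) ^ 2 ≤ 1 / 4 * N := by
      intro i hi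
      have h5 : (i : ℝ) ≤ Real.sqrt N / 2 := by
        refine le_trans ?_ (Nat.floor_le (by positivity))
        exact_mod_cast Nat.lt_succ_iff.1 hi
      calc (i : ℝ) ^ 2 ≤ (Real.sqrt N / 2) ^ 2 := by gcongr
        _ = 1 / 4 * (N : ℝ) := by rw [div_pow, Real.sq_sqrt hN0.le]; ring
    have hm' : ∀ i < I, i ^ 2 < N := by
      intro i hi
      have := hm i hi
      have h8 : ((i ^ 2 : ℕ) : ℝ) < N := by
        rw [Nat.cast_pow]
        linarith
      exact_mod_cast h8
    have h := sum_card_sphere_le d N (Finset.range I) fun i hi => (hm' i (Finset.mem_range.1 hi)).le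
    have h' : (∑ i ∈ Finset.range I, ((sphere d (Real.sqrt ((N - i ^ 2 : ℕ) : ℝ))).card : ℝ)) ≤
        (sphere (d + 1) (Real.sqrt N)).card := by exact_mod_cast h
    refine le_trans ?_ h'
    calc c * (3 / 4) ^ ((d : ℝ) / 2 - 1) / 2 * (N : ℝ) ^ (((d + 1 : ℕ) : ℝ) / 2 - 1)
        = (Real.sqrt N / 2) * (c * (3 / 4 * N) ^ ((d : ℝ) / 2 - 1)) := by
          rw [show (((d + 1 : ℕ) : ℝ) / 2 - 1) = ((d : ℝ) / 2 - 1) + 1 / 2 by push_cast; ring,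
            Real.rpow_add hN0, Real.mul_rpow (by norm_num) hN0.le, Real.sqrt_eq_rpow]
          ring
      _ ≤ I * (c * (3 / 4 * N) ^ ((d : ℝ) / 2 - 1)) := by gcongr
      _ = ∑ i ∈ Finset.range I, c * (3 / 4 * N : ℝ) ^ ((d : ℝ) / 2 - 1) := by simp
      _ ≤ _ := by
          refine Finset.sum_le_sum fun i hi => ?_
          have hi' := Finset.mem_range.1 hi
          refine le_trans ?_ (hcN (N - i ^ 2) (by have := hm' i hi'; omega))
          have := hm i hi'
          rw [Nat.cast_sub (hm' i hi').le, Nat.cast_pow]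
          gcongr
          · linarith
          · linarith

theorem summable_and_tsum_pi_prod {d : ℕ} (g : Fin d → ℤ → ℂ)
    (hg : ∀ i, Summable fun k => ‖g i k‖) :
    (Summable fun m : Fin d → ℤ => ‖∏ i, g i (m i)‖) ∧
      ∑' m : Fin d → ℤ, ∏ i, g i (m i) = ∏ i, ∑' k, g i k := by
  induction d with
  | zero =>
    constructor
    · exact Summable.of_finite
    · rw [tsum_fintype]
      simp
  | succ d ih =>
    obtain ⟨h1, h2⟩ := ih (fun i => g i.succ) (fun i => hg i.succ)
    let e : ℤ × (Fin d → ℤ) ≃ (Fin (d + 1) → ℤ) := Fin.consEquiv fun _ => ℤ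
    have he : ∀ p : ℤ × (Fin d → ℤ), ∏ i, g i (e p i) = g 0 p.1 * ∏ i, g (Fin.succ i) (p.2 i) := by
      intro p
      rw [Fin.prod_univ_succ]
      simp [e, Fin.consEquiv]
    constructor
    · rw [← e.summable_iff]
      refine ((hg 0).mul_norm h1).congr fun p => ?_
      rw [Function.comp_apply, he]
    · rw [← e.tsum_eq, Fin.prod_univ_succ, ← h2, tsum_mul_tsum_of_summable_norm (hg 0) h1]
      exact tsum_congr he

/-- The Gaussian-regularised quadratic phase `exp (-2π (ε - i t) |m|²)` on `ℤ^d`. -/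
def gaussPhase {d : ℕ} (ε t : ℝ) (m : Fin d → ℤ) : ℂ :=
  Complex.exp (-2 * Real.pi * (ε - Complex.I * t) * ((∑ i, m i ^ 2 : ℤ) : ℂ))

/-- The Gaussian weight `exp (-2π ε |m|²)` on `ℤ^d`. -/
def gaussWeight {d : ℕ} (ε : ℝ) (m : Fin d → ℤ) : ℝ :=
  Real.exp (-2 * Real.pi * ε * ((∑ i, m i ^ 2 : ℤ) : ℝ))

theorem gaussPhase_eq {d : ℕ} (ε t : ℝ) (m : Fin d → ℤ) :
    gaussPhase ε t m = gaussWeight ε m *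
      Complex.exp ((2 * Real.pi * ((∑ i, m i ^ 2 : ℤ) : ℝ) * t : ℝ) * Complex.I) := by
  rw [gaussPhase, gaussWeight, Complex.ofReal_exp, ← Complex.exp_add]
  congr 1
  push_cast
  ring

theorem norm_gaussPhase {d : ℕ} (ε t : ℝ) (m : Fin d → ℤ) :
    ‖gaussPhase ε t m‖ = gaussWeight ε m := by
  rw [gaussPhase_eq, norm_mul, Complex.norm_exp_ofReal_mul_I, mul_one, Complex.norm_real,
    Real.norm_of_nonneg]
  exact (Real.exp_pos _).le

theorem continuous_gaussPhase {d : ℕ} (ε : ℝ) (m : Fin d → ℤ) :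
    Continuous fun t => gaussPhase ε t m := by
  unfold gaussPhase
  fun_prop

theorem gaussPhase_mul_mFourier {d : ℕ} (ε t : ℝ) (m : Fin d → ℤ) (β : Fin d → ℝ) :
    gaussPhase ε t m * UnitAddTorus.mFourier (-m) (fun i => (β i : UnitAddCircle)) =
      ∏ i, Complex.exp (-2 * Real.pi * (ε - Complex.I * t) * (m i) ^ 2 -
        2 * Real.pi * Complex.I * (m i) * β i) := by
  simp only [UnitAddTorus.mFourier, ContinuousMap.coe_mk, Pi.neg_apply, fourier_coe_apply]
  rw [gaussPhase, ← Complex.exp_sum, ← Complex.exp_add, ← Complex.exp_sum]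
  congr 1
  push_cast
  rw [Finset.mul_sum, ← Finset.sum_add_distrib]
  refine Finset.sum_congr rfl fun i _ => ?_
  ring

theorem summable_gaussWeight {d : ℕ} {ε : ℝ} (hε : 0 < ε) :
    Summable (gaussWeight ε : (Fin d → ℤ) → ℝ) := by
  have h := (summable_and_tsum_pi_prod (d := d)
    (fun _ k => Complex.exp (-2 * Real.pi * (ε - Complex.I * (0 : ℝ)) * (k : ℤ) ^ 2 -
        2 * Real.pi * Complex.I * k * (0 : ℝ))) (fun _ => summable_norm_theta ε 0 0 hε)).1
  refine h.congr fun m => ?_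
  have h2 := gaussPhase_mul_mFourier ε 0 m (fun _ => 0)
  rw [← h2, norm_mul, norm_gaussPhase]
  simp [UnitAddTorus.mFourier]

/-- The `d`-dimensional theta function, the multiplier of convolution with `gaussPhase`. -/
def torusTheta {d : ℕ} (ε t : ℝ) (α : UnitAddTorus (Fin d)) : ℂ :=
  ∑' m, gaussPhase ε t m * UnitAddTorus.mFourier (-m) α

theorem torusTheta_coe {d : ℕ} {ε : ℝ} (hε : 0 < ε) (t : ℝ) (β : Fin d → ℝ) :
    torusTheta ε t (fun i => (β i : UnitAddCircle)) = ∏ i, theta ε t (β i) := by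
  rw [torusTheta]
  simp_rw [gaussPhase_mul_mFourier]
  exact (summable_and_tsum_pi_prod _ (fun i => summable_norm_theta ε t (β i) hε)).2

theorem norm_mFourier_apply {d : ℕ} (n : Fin d → ℤ) (α : UnitAddTorus (Fin d)) :
    ‖UnitAddTorus.mFourier n α‖ = 1 := by
  simp only [UnitAddTorus.mFourier, ContinuousMap.coe_mk, norm_prod, fourier_apply, Circle.norm_coe,
    Finset.prod_const_one]

theorem continuous_torusTheta {d : ℕ} {ε : ℝ} (hε : 0 < ε) :
    Continuous fun p : ℝ × UnitAddTorus (Fin d) => torusTheta ε p.1 p.2 := by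
  unfold torusTheta
  refine continuous_tsum (fun m => ?_) (summable_gaussWeight hε) (fun m p => ?_)
  · exact ((continuous_gaussPhase ε m).comp continuous_fst).mul
      ((UnitAddTorus.mFourier (-m)).continuous.comp continuous_snd)
  · rw [norm_mul, norm_gaussPhase, norm_mFourier_apply, mul_one]

/-- Convolution of `f` with `gaussPhase`. -/
def gaussConv {d : ℕ} (ε t : ℝ) (f : (Fin d → ℤ) → ℂ) (n : Fin d → ℤ) : ℂ :=
  ∑' m, gaussPhase ε t m * f (n - m)

theorem norm_apply_le (d : ℕ) (f : lp (fun _ : Fin d → ℤ => ℂ) 2) (n : Fin d → ℤ) :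
    ‖f n‖ ≤ ‖f‖ := lp.norm_apply_le_norm two_ne_zero f n

theorem continuous_gaussConv {d : ℕ} {ε : ℝ} (hε : 0 < ε) (f : lp (fun _ : Fin d → ℤ => ℂ) 2)
    (n : Fin d → ℤ) : Continuous fun t => gaussConv ε t f n := by
  unfold gaussConv
  refine continuous_tsum (fun m => (continuous_gaussPhase ε m).mul continuous_const)
    ((summable_gaussWeight hε).mul_right ‖f‖) (fun m t => ?_)
  rw [norm_mul, norm_gaussPhase]
  exact mul_le_mul_of_nonneg_left (norm_apply_le d f _) (Real.exp_pos _).le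

theorem integral_Ioc_exp_int (k : ℤ) :
    ∫ t in Set.Ioc (0 : ℝ) 1, Complex.exp ((2 * Real.pi * (k : ℝ) * t : ℝ) * Complex.I) =
      if k = 0 then 1 else 0 := by
  rw [← intervalIntegral.integral_of_le zero_le_one]
  split_ifs with h
  · subst h
    simp
  · have hc : (2 * Real.pi * k * Complex.I : ℂ) ≠ 0 := by
      simp [Real.pi_ne_zero, h]
    have : ∀ t : ℝ, Complex.exp ((2 * Real.pi * (k : ℝ) * t : ℝ) * Complex.I) =
        Complex.exp ((2 * Real.pi * k * Complex.I) * t) := by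
      intro t
      congr 1
      push_cast
      ring
    simp_rw [this]
    rw [integral_exp_mul_complex hc]
    have h1 : Complex.exp (2 * Real.pi * k * Complex.I * (1 : ℝ)) = 1 := by
      rw [Complex.exp_eq_one_iff]
      exact ⟨k, by push_cast; ring⟩
    rw [h1]
    simp

theorem sum_sphere_eq_integral {d : ℕ} {ε : ℝ} (hε : 0 < ε) (f : lp (fun _ : Fin d → ℤ => ℂ) 2)
    (n : Fin d → ℤ) (N : ℕ) :
    ∑ m ∈ sphere d (Real.sqrt N), f (n - m) = Real.exp (2 * Real.pi * ε * N) *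
      ∫ t in Set.Ioc (0 : ℝ) 1,
        Complex.exp ((2 * Real.pi * ((-N : ℤ) : ℝ) * t : ℝ) * Complex.I) * gaussConv ε t f n := by
  have hcont : ∀ m : Fin d → ℤ, Continuous fun t : ℝ =>
      Complex.exp ((2 * Real.pi * ((-N : ℤ) : ℝ) * t : ℝ) * Complex.I) *
        (gaussPhase ε t m * f (n - m)) := fun m =>
    Continuous.mul (by fun_prop) ((continuous_gaussPhase ε m).mul continuous_const)
  have h := hasSum_integral_of_summable_integral_norm (μ := volume.restrict (Set.Ioc (0 : ℝ) 1))
    (F := fun (m : Fin d → ℤ) (t : ℝ) =>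
      Complex.exp ((2 * Real.pi * ((-N : ℤ) : ℝ) * t : ℝ) * Complex.I) *
        (gaussPhase ε t m * f (n - m)))
    (fun m => ((hcont m).integrableOn_Icc).mono_set Set.Ioc_subset_Icc_self) (by
      simp_rw [norm_mul, Complex.norm_exp_ofReal_mul_I, one_mul, norm_gaussPhase]
      refine Summable.of_nonneg_of_le
        (fun m => integral_nonneg fun t => mul_nonneg (Real.exp_pos _).le (norm_nonneg _))
        (fun m => ?_) ((summable_gaussWeight hε).mul_right ‖f‖)
      rw [integral_const]
      simp only [measureReal_restrict_apply MeasurableSet.univ, Set.univ_inter, Real.volume_real_Ioc,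
        sub_zero, smul_eq_mul]
      rw [max_eq_left zero_le_one, one_mul]
      exact mul_le_mul_of_nonneg_left (norm_apply_le d f _) (Real.exp_pos _).le)
  have hintg : ∀ m : Fin d → ℤ, ∫ t in Set.Ioc (0 : ℝ) 1,
      Complex.exp ((2 * Real.pi * ((-N : ℤ) : ℝ) * t : ℝ) * Complex.I) *
        (gaussPhase ε t m * f (n - m)) =
      if m ∈ sphere d (Real.sqrt N) then Real.exp (-(2 * Real.pi * ε * N)) * f (n - m) else 0 := by
    intro m
    have h1 : ∀ t : ℝ, Complex.exp ((2 * Real.pi * ((-N : ℤ) : ℝ) * t : ℝ) * Complex.I) *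
        (gaussPhase ε t m * f (n - m)) = (gaussWeight ε m * f (n - m)) *
          Complex.exp ((2 * Real.pi * (((∑ i, m i ^ 2) - N : ℤ) : ℝ) * t : ℝ) * Complex.I) := by
      intro t
      have : Complex.exp ((2 * Real.pi * (((∑ i, m i ^ 2) - N : ℤ) : ℝ) * t : ℝ) * Complex.I) =
          Complex.exp ((2 * Real.pi * ((-N : ℤ) : ℝ) * t : ℝ) * Complex.I) *
          Complex.exp ((2 * Real.pi * ((∑ i, m i ^ 2 : ℤ) : ℝ) * t : ℝ) * Complex.I) := by
        rw [← Complex.exp_add]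
        congr 1
        push_cast
        ring
      rw [this, gaussPhase_eq]
      ring
    simp_rw [h1]
    rw [integral_const_mul, integral_Ioc_exp_int]
    by_cases hm : m ∈ sphere d (Real.sqrt N)
    · have hm' := mem_sphere_sqrt.1 hm
      rw [if_pos hm, if_pos (by rw [hm']; ring), gaussWeight, hm', mul_one]
      congr 3
      push_cast
      ring
    · have hm' := fun h' => hm (mem_sphere_sqrt.2 h')
      rw [if_neg hm, if_neg (fun h' => hm' (by linarith)), mul_zero]
  have htsum : ∀ t : ℝ, ∑' m : Fin d → ℤ,
      Complex.exp ((2 * Real.pi * ((-N : ℤ) : ℝ) * t : ℝ) * Complex.I) *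
        (gaussPhase ε t m * f (n - m)) =
      Complex.exp ((2 * Real.pi * ((-N : ℤ) : ℝ) * t : ℝ) * Complex.I) * gaussConv ε t f n :=
    fun t => tsum_mul_left
  simp_rw [hintg, htsum] at h
  have h3 := h.tsum_eq
  rw [tsum_eq_sum (s := sphere d (Real.sqrt N)) (fun m hm => if_neg hm)] at h3
  rw [← h3, Finset.sum_congr rfl (fun m hm => if_pos hm), ← Finset.mul_sum, ← mul_assoc,
    ← Complex.ofReal_mul, ← Real.exp_add, add_neg_cancel, Real.exp_zero, Complex.ofReal_one,
    one_mul]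

theorem enorm_sum_sphere_le {d : ℕ} {ε : ℝ} (hε : 0 < ε) (f : lp (fun _ : Fin d → ℤ => ℂ) 2)
    (n : Fin d → ℤ) (N : ℕ) :
    ‖∑ m ∈ sphere d (Real.sqrt N), f (n - m)‖ₑ ≤ ENNReal.ofReal (Real.exp (2 * Real.pi * ε * N)) *
      ∫⁻ t in Set.Ioc (0 : ℝ) 1, ‖gaussConv ε t f n‖ₑ := by
  rw [sum_sphere_eq_integral hε, enorm_mul]
  gcongr
  · rw [← ofReal_norm, Complex.norm_real, Real.norm_of_nonneg (Real.exp_pos _).le]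
  · refine (enorm_integral_le_lintegral_enorm _).trans (le_of_eq ?_)
    refine lintegral_congr fun t => ?_
    rw [enorm_mul, ← ofReal_norm (Complex.exp _), Complex.norm_exp_ofReal_mul_I]
    simp

theorem tsum_enorm_sq_integral_mFourier {d : ℕ} (h : Lp ℂ 2 (torusMeasure d)) :
    ∑' n : Fin d → ℤ, ‖∫ α, UnitAddTorus.mFourier n α * h α ∂torusMeasure d‖ₑ ^ 2 =
      ∫⁻ α, ‖h α‖ₑ ^ 2 ∂torusMeasure d := by
  have hs : HasSum (fun n => ‖UnitAddTorus.mFourierCoeff (d := Fin d) h n‖ ^ 2)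
      (∫ α, ‖h α‖ ^ 2 ∂torusMeasure d) := UnitAddTorus.hasSum_sq_mFourierCoeff (d := Fin d) h
  have h1 : ∀ n, UnitAddTorus.mFourierCoeff (d := Fin d) h (-n) =
      ∫ α, UnitAddTorus.mFourier n α * h α ∂torusMeasure d := by
    intro n
    have : UnitAddTorus.mFourierCoeff (d := Fin d) h (-n) =
      ∫ α, UnitAddTorus.mFourier (- -n) α • h α ∂torusMeasure d := rfl
    rw [this, neg_neg]
    rfl
  have hs' : HasSum (fun n : Fin d → ℤ => ‖∫ α, UnitAddTorus.mFourier n α * h α ∂torusMeasure d‖ ^ 2)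
      (∫ α, ‖h α‖ ^ 2 ∂torusMeasure d) := by
    rw [← (Equiv.neg (Fin d → ℤ)).hasSum_iff] at hs
    convert hs using 1
    ext n
    rw [Function.comp_apply, Equiv.neg_apply, h1]
  have hintg : Integrable (fun α => ‖h α‖ ^ 2) (torusMeasure d) :=
    (memLp_two_iff_integrable_sq_norm (Lp.aestronglyMeasurable h)).1 (Lp.memLp h)
  have e1 : ∀ z : ℂ, ‖z‖ₑ ^ 2 = ENNReal.ofReal (‖z‖ ^ 2) := fun z => by
    rw [ENNReal.ofReal_pow (norm_nonneg _), ofReal_norm]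
  simp_rw [e1]
  rw [← ofReal_integral_eq_lintegral_ofReal hintg (Filter.Eventually.of_forall fun _ => by positivity),
    ← hs'.tsum_eq, ENNReal.ofReal_tsum_of_nonneg (fun _ => by positivity) hs'.summable]

theorem integral_mFourier_mul_fourierTransform {d : ℕ} (f : lp (fun _ : Fin d → ℤ => ℂ) 2)
    (n : Fin d → ℤ) :
    ∫ α, UnitAddTorus.mFourier n α * fourierTransform f α ∂torusMeasure d = f n := by
  have h1 : inner ℂ (char n) (fourierTransform f) = f n := by
    have hs := (hasSum_fourierTransform f).mapL (innerSL ℂ (char n))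
    have h2 : ∀ m, innerSL ℂ (char n) (f m • char m) = if m = n then f n else 0 := by
      intro m
      rw [map_smul, innerSL_apply_apply, orthonormal_iff_ite.1 (char_orthonormal d)]
      by_cases h : n = m
      · subst h; simp
      · rw [if_neg h, if_neg (Ne.symm h), smul_zero]
    simp_rw [h2] at hs
    exact (hs.unique (hasSum_ite_eq n (f n)))
  rw [← h1, L2.inner_def]
  refine integral_congr_ae ?_
  filter_upwards [ContinuousMap.coeFn_toLp (𝕜 := ℂ) (p := 2) (torusMeasure d)
    (UnitAddTorus.mFourier (-n))] with α hα
  rw [char, hα, UnitAddTorus.mFourier_neg, RCLike.inner_apply, RCLike.conj_conj, mul_comm]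

theorem tsum_enorm_sq_gaussConv {d : ℕ} {ε : ℝ} (hε : 0 < ε) (t : ℝ)
    (f : lp (fun _ : Fin d → ℤ => ℂ) 2) :
    ∑' n, ‖gaussConv ε t f n‖ₑ ^ 2 =
      ∫⁻ α, ‖torusTheta ε t α‖ₑ ^ 2 * ‖fourierTransform f α‖ₑ ^ 2 ∂torusMeasure d := by
  have hΘ : Continuous fun α : UnitAddTorus (Fin d) => torusTheta ε t α :=
    Continuous.comp (g := fun p : ℝ × UnitAddTorus (Fin d) => torusTheta ε p.1 p.2)
      (continuous_torusTheta hε) (f := fun α => (t, α)) (by fun_prop)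
  have hmem : MemLp (fun α => torusTheta ε t α * fourierTransform f α) 2 (torusMeasure d) := by
    have h1 : MemLp (fun α : UnitAddTorus (Fin d) => torusTheta ε t α) ∞ (torusMeasure d) := by
      refine memLp_top_of_bound hΘ.aestronglyMeasurable (∑' m : Fin d → ℤ, gaussWeight ε m) ?_
      refine Filter.Eventually.of_forall fun α => ?_
      refine tsum_of_norm_bounded (summable_gaussWeight hε).hasSum fun m => ?_
      rw [norm_mul, norm_gaussPhase, norm_mFourier_apply, mul_one]
    exact (Lp.memLp (fourierTransform f)).mul' h1
  have hfint : Integrable (fourierTransform f) (torusMeasure d) :=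
    (Lp.memLp (fourierTransform f)).integrable one_le_two
  have hcoef : ∀ n : Fin d → ℤ, ∫ α, UnitAddTorus.mFourier n α *
      (torusTheta ε t α * fourierTransform f α) ∂torusMeasure d = gaussConv ε t f n := by
    intro n
    have hi : ∀ k : Fin d → ℤ, Integrable (fun α => UnitAddTorus.mFourier k α *
        fourierTransform f α) (torusMeasure d) := fun k =>
      hfint.bdd_mul (c := 1) (UnitAddTorus.mFourier k).continuous.aestronglyMeasurable
        (Filter.Eventually.of_forall fun α => (norm_mFourier_apply k α).le)
    have h := hasSum_integral_of_summable_integral_norm (μ := torusMeasure d)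
      (F := fun (m : Fin d → ℤ) α => gaussPhase ε t m *
        (UnitAddTorus.mFourier (n - m) α * fourierTransform f α))
      (fun m => (hi _).const_mul _) (by
        simp_rw [norm_mul, norm_gaussPhase, norm_mFourier_apply, one_mul, integral_const_mul]
        exact (summable_gaussWeight hε).mul_right _)
    simp_rw [integral_const_mul, integral_mFourier_mul_fourierTransform] at h
    rw [gaussConv, h.tsum_eq]
    refine integral_congr_ae (Filter.Eventually.of_forall fun α => ?_)
    simp only
    rw [torusTheta, mul_left_comm, ← tsum_mul_right]
    refine tsum_congr fun m => ?_
    rw [sub_eq_add_neg, UnitAddTorus.mFourier_add]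
    ring
  have h := tsum_enorm_sq_integral_mFourier hmem.toLp
  have h2 := hmem.coeFn_toLp
  have h3 : ∀ n : Fin d → ℤ, ∫ α, UnitAddTorus.mFourier n α * hmem.toLp _ α ∂torusMeasure d =
      gaussConv ε t f n := by
    intro n
    rw [← hcoef n]
    refine integral_congr_ae ?_
    filter_upwards [h2] with α hα
    rw [hα]
  simp_rw [h3] at h
  rw [h]
  refine lintegral_congr_ae ?_
  filter_upwards [h2] with α hα
  rw [hα, enorm_mul, mul_pow]

theorem tsum_enorm_sq_eq {d : ℕ} (f : lp (fun _ : Fin d → ℤ => ℂ) 2) :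
    ∑' n, ‖f n‖ₑ ^ 2 = ∫⁻ α, ‖fourierTransform f α‖ₑ ^ 2 ∂torusMeasure d := by
  rw [← tsum_enorm_sq_integral_mFourier]
  simp_rw [integral_mFourier_mul_fourierTransform]

theorem sq_lintegral_le_weighted {X : Type*} [MeasurableSpace X] {μ : Measure X} {W g : X → ℝ≥0∞}
    (hW : AEMeasurable W μ) (hg : AEMeasurable g μ) (h0 : ∀ᵐ x ∂μ, W x ≠ 0)
    (htop : ∀ᵐ x ∂μ, W x ≠ ∞) :
    (∫⁻ x, g x ∂μ) ^ 2 ≤ (∫⁻ x, W x ∂μ) * ∫⁻ x, (W x)⁻¹ * g x ^ 2 ∂μ := by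
  have hcs := ENNReal.lintegral_mul_le_Lp_mul_Lq μ Real.HolderConjugate.two_two
    (f := fun x => W x ^ (1 / 2 : ℝ)) (g := fun x => (W x)⁻¹ ^ (1 / 2 : ℝ) * g x)
    (hW.pow_const _) ((hW.inv.pow_const _).mul hg)
  have h1 : ∫⁻ x, ((fun x => W x ^ (1 / 2 : ℝ)) * fun x => (W x)⁻¹ ^ (1 / 2 : ℝ) * g x) x ∂μ =
      ∫⁻ x, g x ∂μ := by
    refine lintegral_congr_ae ?_
    filter_upwards [h0, htop] with x hx0 hxt
    rw [Pi.mul_apply, ← mul_assoc, ← ENNReal.mul_rpow_of_nonneg _ _ (by norm_num),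
      ENNReal.mul_inv_cancel hx0 hxt, ENNReal.one_rpow, one_mul]
  have hsq : ∀ y : ℝ≥0∞, (y ^ (1 / 2 : ℝ)) ^ (2 : ℝ) = y := fun y => by
    rw [← ENNReal.rpow_mul]; norm_num
  have hsq' : ∀ y : ℝ≥0∞, (y ^ (1 / 2 : ℝ)) ^ 2 = y := fun y => by
    rw [← ENNReal.rpow_ofNat, hsq]
  rw [h1] at hcs
  simp_rw [ENNReal.mul_rpow_of_nonneg _ _ zero_le_two, hsq] at hcs
  calc (∫⁻ x, g x ∂μ) ^ 2 ≤ _ := pow_le_pow_left₀ zero_le hcs 2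
    _ = _ := by
      rw [mul_pow, hsq', hsq']
      simp_rw [ENNReal.rpow_ofNat]

/-- A weighted `L²` bound: the supremum over all Fourier coefficients in the time variable is
controlled by the integral of the multiplier against an auxiliary weight. -/
theorem tsum_sq_lintegral_gaussConv_le {d : ℕ} {ε : ℝ} (hε : 0 < ε)
    (f : lp (fun _ : Fin d → ℤ => ℂ) 2) {W : ℝ → ℝ≥0∞} (hW : Measurable W)
    (h0 : ∀ t ∈ Set.Ioc (0 : ℝ) 1, W t ≠ 0) (htop : ∀ t, W t ≠ ∞) {B : ℝ≥0∞}
    (hB : ∀ᵐ α ∂torusMeasure d, fourierTransform f α ≠ 0 →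
      ∫⁻ t in Set.Ioc (0 : ℝ) 1, (W t)⁻¹ * ‖torusTheta ε t α‖ₑ ^ 2 ≤ B) :
    ∑' n, (∫⁻ t in Set.Ioc (0 : ℝ) 1, ‖gaussConv ε t f n‖ₑ) ^ 2 ≤
      (∫⁻ t in Set.Ioc (0 : ℝ) 1, W t) * (B * ∑' n, ‖f n‖ₑ ^ 2) := by
  have hmeas : ∀ n, Measurable fun t => ‖gaussConv ε t f n‖ₑ := fun n =>
    (continuous_gaussConv hε f n).measurable.enorm
  have hΘ : Measurable fun p : ℝ × UnitAddTorus (Fin d) => torusTheta ε p.1 p.2 :=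
    (continuous_torusTheta hε).measurable
  calc ∑' n, (∫⁻ t in Set.Ioc (0 : ℝ) 1, ‖gaussConv ε t f n‖ₑ) ^ 2
      ≤ ∑' n, (∫⁻ t in Set.Ioc (0 : ℝ) 1, W t) *
          ∫⁻ t in Set.Ioc (0 : ℝ) 1, (W t)⁻¹ * ‖gaussConv ε t f n‖ₑ ^ 2 := by
        refine ENNReal.tsum_le_tsum fun n => sq_lintegral_le_weighted hW.aemeasurable
          (hmeas n).aemeasurable ?_ (Filter.Eventually.of_forall htop)
        exact (ae_restrict_iff' measurableSet_Ioc).2 (Filter.Eventually.of_forall h0)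
    _ = (∫⁻ t in Set.Ioc (0 : ℝ) 1, W t) *
          ∫⁻ t in Set.Ioc (0 : ℝ) 1, (W t)⁻¹ * ∑' n, ‖gaussConv ε t f n‖ₑ ^ 2 := by
        have hm : ∀ n, AEMeasurable (fun t => (W t)⁻¹ * ‖gaussConv ε t f n‖ₑ ^ 2)
            (volume.restrict (Set.Ioc (0 : ℝ) 1)) := fun n =>
          (hW.inv.mul ((hmeas n).pow_const 2)).aemeasurable
        rw [ENNReal.tsum_mul_left, ← lintegral_tsum hm]
        simp_rw [ENNReal.tsum_mul_left]
    _ = (∫⁻ t in Set.Ioc (0 : ℝ) 1, W t) * ∫⁻ α, (∫⁻ t in Set.Ioc (0 : ℝ) 1,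
          (W t)⁻¹ * (‖torusTheta ε t α‖ₑ ^ 2 * ‖fourierTransform f α‖ₑ ^ 2)) ∂torusMeasure d := by
        have hf : AEMeasurable (fun α => fourierTransform f α) (torusMeasure d) :=
          (Lp.aestronglyMeasurable (fourierTransform f)).aemeasurable
        have hjoint : AEMeasurable (Function.uncurry fun (t : ℝ) (α : UnitAddTorus (Fin d)) =>
            (W t)⁻¹ * (‖torusTheta ε t α‖ₑ ^ 2 * ‖fourierTransform f α‖ₑ ^ 2))
            ((volume.restrict (Set.Ioc (0 : ℝ) 1)).prod (torusMeasure d)) := by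
          refine (hW.inv.comp measurable_fst).aemeasurable.mul
            ((hΘ.enorm.pow_const 2).aemeasurable.mul ?_)
          exact (hf.comp_snd.enorm.pow_const 2)
        rw [← lintegral_lintegral_swap hjoint]
        congr 1
        refine lintegral_congr fun t => ?_
        rw [tsum_enorm_sq_gaussConv hε, lintegral_const_mul'']
        have hΘt : Continuous fun α : UnitAddTorus (Fin d) => torusTheta ε t α :=
          Continuous.comp (g := fun p : ℝ × UnitAddTorus (Fin d) => torusTheta ε p.1 p.2)
            (continuous_torusTheta hε) (f := fun α => (t, α)) (by fun_prop)
        exact (hΘt.measurable.enorm.pow_const 2).aemeasurable.mul (hf.enorm.pow_const 2)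
    _ ≤ (∫⁻ t in Set.Ioc (0 : ℝ) 1, W t) * ∫⁻ α, B * ‖fourierTransform f α‖ₑ ^ 2 ∂torusMeasure d := by
        gcongr 1
        refine lintegral_mono_ae ?_
        filter_upwards [hB] with α hα
        by_cases h : fourierTransform f α = 0
        · simp [h]
        · simp_rw [← mul_assoc]
          rw [lintegral_mul_const' _ _ (by finiteness)]
          gcongr
          exact hα h
    _ = _ := by
        rw [lintegral_const_mul'' _ ((Lp.aestronglyMeasurable
          (fourierTransform f)).aemeasurable.enorm.pow_const 2), tsum_enorm_sq_eq]

theorem exists_farey_arc {Q : ℕ} (hQ : 0 < Q) {t : ℝ} (ht : t ∈ Set.Ioc (0 : ℝ) 1) :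
    ∃ q ∈ Finset.Icc 1 Q, ∃ a ∈ (Finset.range (q + 1)).filter (Nat.Coprime q),
      |t - a / q| ≤ 1 / (q * Q) := by
  obtain ⟨r, hr, hden⟩ := Real.exists_rat_abs_sub_le_and_den_le t hQ
  have hd : (0 : ℝ) < r.den := by exact_mod_cast r.den_pos
  have hQ' : (0 : ℝ) < Q := by exact_mod_cast hQ
  have hrr : (r : ℝ) = r.num / r.den := by
    rw [Rat.cast_def]
  have hlt : 1 / (((Q : ℝ) + 1) * r.den) < 1 / r.den := by
    refine one_div_lt_one_div_of_lt hd ?_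
    nlinarith
  rw [abs_le, hrr] at hr
  have h1 : 0 ≤ r.num := by
    by_contra hcon
    have h2 : (r.num : ℝ) ≤ -1 := by exact_mod_cast Int.le_sub_one_of_lt (not_le.1 hcon)
    have h3 : (r.num : ℝ) / r.den ≤ -1 / r.den := by gcongr
    have h4 : (-1 : ℝ) / r.den = -(1 / r.den) := by ring
    have := ht.1
    linarith [hr.2]
  have h2 : r.num ≤ r.den := by
    by_contra hcon
    have h2 : (r.den : ℝ) + 1 ≤ r.num := by exact_mod_cast Int.add_one_le_of_lt (not_le.1 hcon)
    have h3 : ((r.den : ℝ) + 1) / r.den ≤ r.num / r.den := by gcongr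
    have h4 : ((r.den : ℝ) + 1) / r.den = 1 + 1 / r.den := by field_simp
    have := ht.2
    linarith [hr.1]
  obtain ⟨a, ha⟩ := Int.eq_ofNat_of_zero_le h1
  refine ⟨r.den, Finset.mem_Icc.2 ⟨r.den_pos, hden⟩, a, ?_, ?_⟩
  · rw [Finset.mem_filter, Finset.mem_range]
    refine ⟨by omega, ?_⟩
    have := r.reduced
    rw [ha, Int.natAbs_natCast] at this
    exact this.symm
  · have h5 : (r.num : ℝ) = a := by rw [ha]; simp
    rw [h5] at hr
    refine (abs_le.2 hr).trans ?_
    refine one_div_le_one_div_of_le (by positivity) ?_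
    nlinarith

/-- The convergent integral `∫ (1 + x²)^(-5/8)`. -/
def decayIntegral : ℝ := ∫ x : ℝ, (1 + ‖x‖ ^ 2) ^ (-(5 / 4 : ℝ) / 2)

theorem decayIntegral_nonneg : 0 ≤ decayIntegral :=
  integral_nonneg fun x => by positivity

theorem lintegral_rpow_neg_le {ε e : ℝ} (hε : 0 < ε) (he : 5 / 8 ≤ e) :
    ∫⁻ τ : ℝ, ENNReal.ofReal ((ε ^ 2 + τ ^ 2) ^ (-e)) ≤
      ENNReal.ofReal (decayIntegral * ε ^ (1 - 2 * e)) := by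
  have hintg : Integrable fun x : ℝ => (1 + ‖x‖ ^ 2) ^ (-(5 / 4 : ℝ) / 2) :=
    integrable_rpow_neg_one_add_norm_sq (by simp; norm_num)
  have hintg' : Integrable fun τ : ℝ => ε ^ (-(2 * e)) * (1 + ‖ε⁻¹ * τ‖ ^ 2) ^ (-(5 / 4 : ℝ) / 2) :=
    (hintg.comp_mul_left' (inv_ne_zero hε.ne')).const_mul _
  have hval : ∫ τ : ℝ, ε ^ (-(2 * e)) * (1 + ‖ε⁻¹ * τ‖ ^ 2) ^ (-(5 / 4 : ℝ) / 2) =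
      decayIntegral * ε ^ (1 - 2 * e) := by
    rw [integral_const_mul, Measure.integral_comp_mul_left
      (fun x : ℝ => (1 + ‖x‖ ^ 2) ^ (-(5 / 4 : ℝ) / 2)), inv_inv, abs_of_pos hε, smul_eq_mul,
      show 1 - 2 * e = -(2 * e) + 1 by ring, Real.rpow_add hε, Real.rpow_one, decayIntegral]
    ring
  rw [← hval, ofReal_integral_eq_lintegral_ofReal hintg'
    (Filter.Eventually.of_forall fun τ => by positivity)]
  refine lintegral_mono fun τ => ENNReal.ofReal_le_ofReal ?_
  have h1 : ε ^ 2 + τ ^ 2 = ε ^ (2 : ℝ) * (1 + ‖ε⁻¹ * τ‖ ^ 2) := by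
    rw [Real.norm_eq_abs, sq_abs, Real.rpow_two]
    field_simp
  rw [h1, Real.mul_rpow (by positivity) (by positivity), ← Real.rpow_mul hε.le,
    show (2 : ℝ) * -e = -(2 * e) by ring]
  refine mul_le_mul_of_nonneg_left ?_ (by positivity)
  refine Real.rpow_le_rpow_of_exponent_le ?_ (by linarith)
  have : 0 ≤ ‖ε⁻¹ * τ‖ ^ 2 := by positivity
  linarith

theorem rpow_neg_quarter_le {d q : ℕ} (hd : 5 ≤ d) (hq : 1 ≤ q) {x : ℝ} (hx : 0 < x) :
    ((q : ℝ) ^ 2 * x) ^ (-(d : ℝ) / 4) ≤ (q : ℝ) ^ (-(5 / 2) : ℝ) * x ^ (-((d : ℝ) / 4)) := by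
  have hq' : (1 : ℝ) ≤ q := by exact_mod_cast hq
  have hd' : (5 : ℝ) ≤ d := by exact_mod_cast hd
  rw [Real.mul_rpow (by positivity) hx.le, ← Real.rpow_natCast, ← Real.rpow_mul (by positivity),
    neg_div]
  refine mul_le_mul_of_nonneg_right ?_ (by positivity)
  refine Real.rpow_le_rpow_of_exponent_le hq' ?_
  push_cast
  linarith

theorem lintegral_arc_weight_le {d q : ℕ} (hd : 5 ≤ d) (hq : 1 ≤ q) {ε : ℝ} (hε : 0 < ε) :
    ∫⁻ τ : ℝ, ENNReal.ofReal (((q : ℝ) ^ 2 * (ε ^ 2 + τ ^ 2)) ^ (-(d : ℝ) / 4)) ≤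
      ENNReal.ofReal (decayIntegral * ε ^ (1 - (d : ℝ) / 2) * (q : ℝ) ^ (-(5 / 2) : ℝ)) := by
  have hd' : (5 : ℝ) ≤ d := by exact_mod_cast hd
  calc _ ≤ ∫⁻ τ : ℝ, ENNReal.ofReal ((q : ℝ) ^ (-(5 / 2) : ℝ)) *
        ENNReal.ofReal ((ε ^ 2 + τ ^ 2) ^ (-((d : ℝ) / 4))) := by
        refine lintegral_mono fun τ => ?_
        rw [← ENNReal.ofReal_mul (by positivity)]
        exact ENNReal.ofReal_le_ofReal (rpow_neg_quarter_le hd hq (by positivity))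
    _ = ENNReal.ofReal ((q : ℝ) ^ (-(5 / 2) : ℝ)) *
        ∫⁻ τ : ℝ, ENNReal.ofReal ((ε ^ 2 + τ ^ 2) ^ (-((d : ℝ) / 4))) :=
        lintegral_const_mul' _ _ ENNReal.ofReal_ne_top
    _ ≤ ENNReal.ofReal ((q : ℝ) ^ (-(5 / 2) : ℝ)) *
        ENNReal.ofReal (decayIntegral * ε ^ (1 - 2 * ((d : ℝ) / 4))) := by
        gcongr
        exact lintegral_rpow_neg_le hε (by linarith)
    _ = _ := by
        rw [← ENNReal.ofReal_mul (by positivity)]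
        congr 1
        rw [show 1 - 2 * ((d : ℝ) / 4) = 1 - (d : ℝ) / 2 by ring]
        ring

theorem exp_neg_le_rpow {x : ℝ} (hx : 0 < x) : Real.exp (-x) ≤ x ^ (-(5 / 8) : ℝ) := by
  rw [Real.exp_neg, Real.rpow_neg hx.le]
  refine inv_anti₀ (by positivity) ?_
  rcases le_total x 1 with h | h
  · exact (Real.rpow_le_one hx.le h (by norm_num)).trans (Real.one_le_exp hx.le)
  · calc x ^ (5 / 8 : ℝ) ≤ x ^ (1 : ℝ) := Real.rpow_le_rpow_of_exponent_le h (by norm_num)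
      _ = x := Real.rpow_one x
      _ ≤ Real.exp x := by linarith [Real.add_one_le_exp x]

theorem lintegral_arc_weight_exp_le {d q : ℕ} (hd : 5 ≤ d) (hq : 1 ≤ q) {ε Y : ℝ} (hε : 0 < ε)
    (hY : 0 < Y) :
    ∫⁻ τ : ℝ, ENNReal.ofReal (((q : ℝ) ^ 2 * (ε ^ 2 + τ ^ 2)) ^ (-(d : ℝ) / 4) *
      Real.exp (-(ε * (ε * Y) / (ε ^ 2 + τ ^ 2)))) ≤
      ENNReal.ofReal (decayIntegral * ε ^ (1 - (d : ℝ) / 2) * (q : ℝ) ^ (-(5 / 2) : ℝ) *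
        Y ^ (-(5 / 8) : ℝ)) := by
  have hd' : (5 : ℝ) ≤ d := by exact_mod_cast hd
  have hpt : ∀ τ : ℝ, ((q : ℝ) ^ 2 * (ε ^ 2 + τ ^ 2)) ^ (-(d : ℝ) / 4) *
      Real.exp (-(ε * (ε * Y) / (ε ^ 2 + τ ^ 2))) ≤
      ((q : ℝ) ^ (-(5 / 2) : ℝ) * Y ^ (-(5 / 8) : ℝ) * ε ^ (-(5 / 4) : ℝ)) *
        (ε ^ 2 + τ ^ 2) ^ (-((d : ℝ) / 4 - 5 / 8)) := by
    intro τ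
    have hx : 0 < ε ^ 2 + τ ^ 2 := by positivity
    calc _ ≤ ((q : ℝ) ^ (-(5 / 2) : ℝ) * (ε ^ 2 + τ ^ 2) ^ (-((d : ℝ) / 4))) *
          (ε * (ε * Y) / (ε ^ 2 + τ ^ 2)) ^ (-(5 / 8) : ℝ) :=
          mul_le_mul (rpow_neg_quarter_le hd hq hx) (exp_neg_le_rpow (by positivity))
            (by positivity) (by positivity)
      _ = _ := by
          rw [show ε * (ε * Y) = ε ^ (2 : ℝ) * Y by rw [Real.rpow_two]; ring,
            Real.div_rpow (by positivity) hx.le, Real.mul_rpow (by positivity) hY.le,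
            ← Real.rpow_mul hε.le, show -((d : ℝ) / 4 - 5 / 8) = -((d : ℝ) / 4) - (-(5 / 8)) by ring,
            Real.rpow_sub hx, show (2 : ℝ) * -(5 / 8) = -(5 / 4) by norm_num]
          ring
  calc _ ≤ ∫⁻ τ : ℝ, ENNReal.ofReal
        ((q : ℝ) ^ (-(5 / 2) : ℝ) * Y ^ (-(5 / 8) : ℝ) * ε ^ (-(5 / 4) : ℝ)) *
        ENNReal.ofReal ((ε ^ 2 + τ ^ 2) ^ (-((d : ℝ) / 4 - 5 / 8))) := by
        refine lintegral_mono fun τ => ?_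
        rw [← ENNReal.ofReal_mul (by positivity)]
        exact ENNReal.ofReal_le_ofReal (hpt τ)
    _ = ENNReal.ofReal ((q : ℝ) ^ (-(5 / 2) : ℝ) * Y ^ (-(5 / 8) : ℝ) * ε ^ (-(5 / 4) : ℝ)) *
        ∫⁻ τ : ℝ, ENNReal.ofReal ((ε ^ 2 + τ ^ 2) ^ (-((d : ℝ) / 4 - 5 / 8))) :=
        lintegral_const_mul' _ _ ENNReal.ofReal_ne_top
    _ ≤ ENNReal.ofReal ((q : ℝ) ^ (-(5 / 2) : ℝ) * Y ^ (-(5 / 8) : ℝ) * ε ^ (-(5 / 4) : ℝ)) *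
        ENNReal.ofReal (decayIntegral * ε ^ (1 - 2 * ((d : ℝ) / 4 - 5 / 8))) := by
        gcongr
        exact lintegral_rpow_neg_le hε (by linarith)
    _ = _ := by
        rw [← ENNReal.ofReal_mul (by positivity)]
        congr 1
        rw [show 1 - 2 * ((d : ℝ) / 4 - 5 / 8) = (1 - (d : ℝ) / 2) + 5 / 4 by ring,
          Real.rpow_add hε, Real.rpow_neg hε.le (5 / 4)]
        field_simp

/-- The convergent sum `∑ q^(-13/12)`. -/
def decaySum : ℝ := ∑' q : ℕ, (q : ℝ) ^ (-(13 / 12) : ℝ)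

theorem summable_decaySum : Summable fun q : ℕ => (q : ℝ) ^ (-(13 / 12) : ℝ) :=
  Real.summable_nat_rpow.2 (by norm_num)

theorem decaySum_nonneg : 0 ≤ decaySum := tsum_nonneg fun _ => by positivity

theorem sum_rpow_le_decaySum (S : Finset ℕ) (hS : ∀ q ∈ S, 1 ≤ q) :
    ∑ q ∈ S, (q : ℝ) ^ (-(3 / 2) : ℝ) ≤ decaySum := by
  refine le_trans (Finset.sum_le_sum fun q hq => ?_)
    (summable_decaySum.sum_le_tsum S fun _ _ => by positivity)
  have : (1 : ℝ) ≤ q := by exact_mod_cast hS q hq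
  exact Real.rpow_le_rpow_of_exponent_le this (by norm_num)

theorem sum_rpow_tail_le (S : Finset ℕ) {T : ℝ} (hT : 0 < T) (hS : ∀ q ∈ S, T ≤ q) :
    ∑ q ∈ S, (q : ℝ) ^ (-(3 / 2) : ℝ) ≤ T ^ (-(5 / 12) : ℝ) * decaySum := by
  calc _ ≤ ∑ q ∈ S, T ^ (-(5 / 12) : ℝ) * (q : ℝ) ^ (-(13 / 12) : ℝ) := by
        refine Finset.sum_le_sum fun q hq => ?_
        have hq0 : (0 : ℝ) < q := hT.trans_le (hS q hq)
        rw [show (-(3 / 2) : ℝ) = -(5 / 12) + -(13 / 12) by norm_num, Real.rpow_add hq0]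
        refine mul_le_mul_of_nonneg_right ?_ (by positivity)
        exact Real.rpow_le_rpow_of_nonpos hT (hS q hq) (by norm_num)
    _ ≤ _ := by
        rw [← Finset.mul_sum]
        exact mul_le_mul_of_nonneg_left
          (summable_decaySum.sum_le_tsum S fun _ _ => by positivity) (by positivity)

theorem sum_rpow_multiples_le (S : Finset ℕ) (hS : ∀ q ∈ S, 1 ≤ q) {s : ℕ} (hs : 0 < s)
    (hdvd : ∀ q ∈ S, s ∣ q) :
    ∑ q ∈ S, (q : ℝ) ^ (-(3 / 2) : ℝ) ≤ (s : ℝ) ^ (-(3 / 2) : ℝ) * decaySum := by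
  have hinj : Set.InjOn (fun q => q / s) (S : Set ℕ) := by
    intro x hx y hy hxy
    have h1 := Nat.div_mul_cancel (hdvd x hx)
    have h2 := Nat.div_mul_cancel (hdvd y hy)
    simp only at hxy
    rw [← h1, ← h2, hxy]
  have h := sum_rpow_le_decaySum (S.image fun q => q / s) (by
    intro u hu
    obtain ⟨q, hq, rfl⟩ := Finset.mem_image.1 hu
    exact Nat.div_pos (Nat.le_of_dvd (hS q hq) (hdvd q hq)) hs)
  rw [Finset.sum_image hinj] at h
  refine le_trans (le_of_eq ?_) (mul_le_mul_of_nonneg_left h (by positivity :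
    (0 : ℝ) ≤ (s : ℝ) ^ (-(3 / 2) : ℝ)))
  rw [Finset.mul_sum]
  refine Finset.sum_congr rfl fun q hq => ?_
  rw [← Real.mul_rpow (by positivity) (by positivity)]
  congr 1
  have h1 := Nat.div_mul_cancel (hdvd q hq)
  rw [mul_comm]
  exact_mod_cast h1.symm

/-- If `x` is at distance greater than `η` from every fraction with denominator at most `P`, then
all denominators `q ≤ R` having a fraction within `η` of `x` are multiples of one integer
exceeding `P`. -/
theorem exists_common_divisor {x η : ℝ} {P R : ℕ} (hη : 2 * η * R ^ 2 ≤ 1)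
    (hx : ∀ (s : ℕ) (l : ℤ), 1 ≤ s → s ≤ P → η < |x + l / s|) :
    ∃ s : ℕ, P < s ∧ ∀ q : ℕ, 1 ≤ q → q ≤ R → (∃ l : ℤ, |x + l / q| < η) → s ∣ q := by
  by_cases hex : ∃ q : ℕ, 1 ≤ q ∧ q ≤ R ∧ ∃ l : ℤ, |x + l / q| < η
  · obtain ⟨q₀, hq₀, hq₀R, l₀, hl₀⟩ := hex
    set ρ : ℚ := l₀ / q₀ with hρ
    have hρR : (ρ : ℝ) = l₀ / q₀ := by rw [hρ]; push_cast; rfl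
    refine ⟨ρ.den, ?_, ?_⟩
    · by_contra hcon
      push Not at hcon
      have := hx ρ.den ρ.num ρ.den_pos hcon
      rw [← Rat.cast_def, hρR] at this
      linarith
    · rintro q hq hqR ⟨l, hl⟩
      have hq' : (1 : ℝ) ≤ q := by exact_mod_cast hq
      have hq₀' : (1 : ℝ) ≤ q₀ := by exact_mod_cast hq₀
      have hqR' : (q : ℝ) ≤ R := by exact_mod_cast hqR
      have hq₀R' : (q₀ : ℝ) ≤ R := by exact_mod_cast hq₀R
      have hdiff : |(l : ℝ) / q - l₀ / q₀| < 2 * η := by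
        calc |(l : ℝ) / q - l₀ / q₀| = |(x + l / q) - (x + l₀ / q₀)| := by ring_nf
          _ ≤ |x + l / q| + |x + l₀ / q₀| := abs_sub _ _
          _ < 2 * η := by linarith
      have hη0 : 0 < η := (abs_nonneg _).trans_lt hl
      have heq : l * q₀ = l₀ * q := by
        have h1 : |((l * q₀ - l₀ * q : ℤ) : ℝ)| < 1 := by
          have h2 : ((l * q₀ - l₀ * q : ℤ) : ℝ) = ((l : ℝ) / q - l₀ / q₀) * (q * q₀) := by
            push_cast
            field_simp
          rw [h2, abs_mul, abs_of_nonneg (by positivity : (0 : ℝ) ≤ q * q₀)]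
          calc _ < 2 * η * (q * q₀) := by gcongr
            _ ≤ 2 * η * (R * R) := by gcongr
            _ ≤ 1 := by rw [← sq]; exact hη
        have h3 : |l * q₀ - l₀ * q| < 1 := by exact_mod_cast h1
        have := Int.abs_lt_one_iff.1 h3
        linarith
      have hρ' : ρ = (l : ℚ) / q := by
        have hq1 : (q : ℚ) ≠ 0 := by exact_mod_cast (by omega : q ≠ 0)
        have hq2 : (q₀ : ℚ) ≠ 0 := by exact_mod_cast (by omega : q₀ ≠ 0)
        rw [hρ, div_eq_div_iff hq2 hq1]
        exact_mod_cast heq.symm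
      have hd := Rat.den_dvd l q
      rw [Rat.divInt_eq_div] at hd
      push_cast at hd
      rw [← hρ'] at hd
      exact_mod_cast hd
  · push Not at hex
    refine ⟨P + 1, Nat.lt_succ_self P, fun q hq hqR ⟨l, hl⟩ => ?_⟩
    exact absurd hl (not_lt.2 (hex q hq hqR l))

theorem dvd_qLcm {j s : ℕ} (hs : 1 ≤ s) (hs' : s ≤ 2 ^ j) : s ∣ qLcm j :=
  Finset.dvd_lcm (f := id) (Finset.mem_Icc.2 ⟨hs, hs'⟩)

theorem qLcm_pos (j : ℕ) : 0 < qLcm j := by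
  rw [Nat.pos_iff_ne_zero, qLcm, Ne, Finset.lcm_eq_zero_iff]
  rintro ⟨x, hx, h0⟩
  have := (Finset.mem_Icc.1 hx).1
  simp only [id] at h0
  omega

theorem sum_arc_decay_le {x : ℝ} {j k : ℕ} (hjk : 7 * j + 1 ≤ k) (Q : ℕ)
    (hx : ∀ l : ℤ, (2 : ℝ) ^ ((j : ℤ) - (k : ℤ)) < |x + l / qLcm j|) (M : ℕ → ℝ)
    (hM1 : ∀ q, M q ≤ 1) (hM : ∀ q : ℕ, (∀ l : ℤ, (2 : ℝ) ^ ((j : ℤ) - (k : ℤ)) ≤ |x + l / q|) →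
      M q ≤ (2 : ℝ) ^ (-(5 / 4 * j) : ℝ)) :
    ∑ q ∈ Finset.Icc 1 Q, (q : ℝ) ^ (-(3 / 2) : ℝ) * M q ≤
      3 * decaySum * (2 : ℝ) ^ (-(5 / 4 * j) : ℝ) := by
  classical
  set η : ℝ := (2 : ℝ) ^ ((j : ℤ) - (k : ℤ)) with hηdef
  set δ : ℝ := (2 : ℝ) ^ (-(5 / 4 * j) : ℝ) with hδ
  have hδ0 : 0 ≤ δ := by positivity
  obtain ⟨s, hs, hsdvd⟩ := exists_common_divisor (x := x) (η := η) (P := 2 ^ j) (R := 8 ^ j) (by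
      rw [hηdef, ← zpow_one_add₀ two_ne_zero]
      push_cast
      rw [show (8 : ℝ) = 2 ^ 3 by norm_num, ← pow_mul, ← pow_mul, ← zpow_natCast (2 : ℝ),
        ← zpow_add₀ two_ne_zero]
      refine zpow_le_one_of_nonpos₀ one_le_two ?_
      push_cast
      omega) (by
      intro s l hs1 hs2
      obtain ⟨c, hc⟩ := dvd_qLcm hs1 hs2
      have hq : (0 : ℝ) < qLcm j := by exact_mod_cast qLcm_pos j
      have h := hx (l * c)
      have hs0 : (s : ℝ) ≠ 0 := by exact_mod_cast (by omega : s ≠ 0)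
      have hqc : (qLcm j : ℝ) = s * c := by exact_mod_cast hc
      have hc0 : (c : ℝ) ≠ 0 := by
        intro h0
        rw [hqc, h0, mul_zero] at hq
        exact lt_irrefl _ hq
      have : ((l * c : ℤ) : ℝ) / qLcm j = l / s := by
        rw [hqc]
        push_cast
        field_simp
      rwa [this] at h)
  set bad : ℕ → Prop := fun q => ∃ l : ℤ, |x + l / q| < η with hbad
  have hterm : ∀ q ∈ Finset.Icc 1 Q, (q : ℝ) ^ (-(3 / 2) : ℝ) * M q ≤
      (q : ℝ) ^ (-(3 / 2) : ℝ) * δ + ((if 8 ^ j < q then (q : ℝ) ^ (-(3 / 2) : ℝ) else 0) +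
        if q ≤ 8 ^ j ∧ bad q then (q : ℝ) ^ (-(3 / 2) : ℝ) else 0) := by
    intro q _
    have hq0 : (0 : ℝ) ≤ (q : ℝ) ^ (-(3 / 2) : ℝ) := by positivity
    have hle := mul_le_mul_of_nonneg_left (hM1 q) hq0
    have hpos : 0 ≤ (q : ℝ) ^ (-(3 / 2) : ℝ) * δ := by positivity
    by_cases h1 : 8 ^ j < q
    · rw [if_pos h1, if_neg (fun h => absurd h.1 (not_le.2 h1))]
      linarith
    · by_cases h2 : bad q
      · rw [if_neg h1, if_pos ⟨not_lt.1 h1, h2⟩]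
        linarith
      · rw [if_neg h1, if_neg (fun h => h2 h.2)]
        have : M q ≤ δ := hM q (by
          intro l
          by_contra hcon
          exact h2 ⟨l, not_le.1 hcon⟩)
        have := mul_le_mul_of_nonneg_left this hq0
        linarith
  refine (Finset.sum_le_sum hterm).trans ?_
  rw [Finset.sum_add_distrib, Finset.sum_add_distrib, ← Finset.sum_mul, ← Finset.sum_filter,
    ← Finset.sum_filter]
  have e1 := sum_rpow_le_decaySum (Finset.Icc 1 Q) fun q hq => (Finset.mem_Icc.1 hq).1
  have e2 := sum_rpow_tail_le ((Finset.Icc 1 Q).filter fun q => 8 ^ j < q) (T := (8 : ℝ) ^ j)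
    (by positivity) (by
      intro q hq
      exact_mod_cast (Finset.mem_filter.1 hq).2.le)
  have e3 := sum_rpow_multiples_le ((Finset.Icc 1 Q).filter fun q => q ≤ 8 ^ j ∧ bad q)
    (fun q hq => (Finset.mem_Icc.1 (Finset.mem_filter.1 hq).1).1) (s := s) (Nat.zero_le _ |>.trans_lt hs) (by
      intro q hq
      obtain ⟨h1, h2, h3⟩ := Finset.mem_filter.1 hq
      exact hsdvd q (Finset.mem_Icc.1 h1).1 h2 h3)
  have e4 : ((8 : ℝ) ^ j) ^ (-(5 / 12) : ℝ) = δ := by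
    rw [hδ, show (8 : ℝ) = 2 ^ (3 : ℝ) by norm_num, ← Real.rpow_natCast,
      ← Real.rpow_mul (by norm_num), ← Real.rpow_mul (by norm_num)]
    congr 1
    ring
  have e5 : (s : ℝ) ^ (-(3 / 2) : ℝ) ≤ δ := by
    have h1 : (2 : ℝ) ^ (j : ℝ) ≤ s := by
      rw [Real.rpow_natCast]
      exact_mod_cast hs.le
    calc (s : ℝ) ^ (-(3 / 2) : ℝ) ≤ ((2 : ℝ) ^ (j : ℝ)) ^ (-(3 / 2) : ℝ) :=
          Real.rpow_le_rpow_of_nonpos (by positivity) h1 (by norm_num)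
      _ = (2 : ℝ) ^ ((j : ℝ) * (-(3 / 2))) := by rw [← Real.rpow_mul (by norm_num)]
      _ ≤ δ := by
        refine Real.rpow_le_rpow_of_exponent_le one_le_two ?_
        have : (0 : ℝ) ≤ j := by positivity
        linarith
  rw [e4] at e2
  have e6 := mul_le_mul_of_nonneg_right e5 decaySum_nonneg
  have e7 := mul_le_mul_of_nonneg_right e1 hδ0
  linarith

/-- The size `(q² (ε² + τ²))^(-d/4)` of the theta function at distance `τ` from `a / q`. -/
def arcWeight (d : ℕ) (ε : ℝ) (q : ℕ) (τ : ℝ) : ℝ :=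
  ((q : ℝ) ^ 2 * (ε ^ 2 + τ ^ 2)) ^ (-(d : ℝ) / 4)

theorem arcWeight_pos {d q : ℕ} {ε : ℝ} (hε : 0 < ε) (hq : 1 ≤ q) (τ : ℝ) :
    0 < arcWeight d ε q τ := by
  have : (0 : ℝ) < q := by exact_mod_cast hq
  unfold arcWeight
  positivity

theorem measurable_arcWeight (d : ℕ) (ε : ℝ) (q : ℕ) : Measurable (arcWeight d ε q) := by
  unfold arcWeight
  fun_prop

/-- Numerators of the reduced fractions in `[0, 1]` with denominator `q`. -/
def numerators (q : ℕ) : Finset ℕ := (Finset.range (q + 1)).filter (Nat.Coprime q)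

theorem card_numerators_le (q : ℕ) : (numerators q).card ≤ q + 1 :=
  (Finset.card_filter_le _ _).trans (Finset.card_range _).le

/-- The weight on `[0, 1]` adapted to the Farey dissection of order `Q`. -/
def fareyWeight (d : ℕ) (ε : ℝ) (Q : ℕ) (t : ℝ) : ℝ≥0∞ :=
  ∑ q ∈ Finset.Icc 1 Q, ∑ a ∈ numerators q,
    {t : ℝ | |t - a / q| ≤ 1 / (q * Q)}.indicator
      (fun t => ENNReal.ofReal (arcWeight d ε q (t - a / q))) t

theorem measurable_fareyWeight (d : ℕ) (ε : ℝ) (Q : ℕ) : Measurable (fareyWeight d ε Q) := by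
  unfold fareyWeight
  refine Finset.measurable_sum _ fun q _ => Finset.measurable_sum _ fun a _ => ?_
  refine Measurable.indicator ?_ (measurableSet_le (by fun_prop) measurable_const)
  exact ((measurable_arcWeight d ε q).comp (by fun_prop)).ennreal_ofReal

theorem fareyWeight_ne_top (d : ℕ) (ε : ℝ) (Q : ℕ) (t : ℝ) : fareyWeight d ε Q t ≠ ∞ := by
  unfold fareyWeight
  refine (ENNReal.sum_lt_top.2 fun q _ => ENNReal.sum_lt_top.2 fun a _ => ?_).ne
  refine (Set.indicator_le_self' (fun _ _ => zero_le) t).trans_lt ENNReal.ofReal_lt_top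

theorem ofReal_arcWeight_le_fareyWeight {d q a Q : ℕ} {ε t : ℝ} (hq : q ∈ Finset.Icc 1 Q)
    (ha : a ∈ numerators q) (ht : |t - a / q| ≤ 1 / (q * Q)) :
    ENNReal.ofReal (arcWeight d ε q (t - a / q)) ≤ fareyWeight d ε Q t := by
  unfold fareyWeight
  refine le_trans (le_trans ?_ (Finset.single_le_sum (fun _ _ => zero_le) ha))
    (Finset.single_le_sum (f := fun q => ∑ a ∈ numerators q,
      {t : ℝ | |t - a / q| ≤ 1 / (q * Q)}.indicator
      (fun t => ENNReal.ofReal (arcWeight d ε q (t - a / q))) t) (fun _ _ => zero_le) hq)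
  rw [Set.indicator_of_mem]
  exact ht

theorem lintegral_sum_arcs_le (Q : ℕ) (g : ℕ → ℝ → ℝ) (hg : ∀ q, Measurable (g q)) {K : ℝ}
    (hK : 0 ≤ K) (M : ℕ → ℝ) (hM : ∀ q, 0 ≤ M q) (h : ∀ q ∈ Finset.Icc 1 Q,
      ∫⁻ τ, ENNReal.ofReal (g q τ) ≤ ENNReal.ofReal (K * (q : ℝ) ^ (-(5 / 2) : ℝ) * M q)) :
    ∫⁻ t, ∑ q ∈ Finset.Icc 1 Q, ∑ a ∈ numerators q, ENNReal.ofReal (g q (t - a / q)) ≤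
      ENNReal.ofReal (2 * K * ∑ q ∈ Finset.Icc 1 Q, (q : ℝ) ^ (-(3 / 2) : ℝ) * M q) := by
  have hmeas : ∀ q a : ℕ, Measurable fun t : ℝ => ENNReal.ofReal (g q (t - a / q)) := fun q a =>
    ((hg q).comp (by fun_prop)).ennreal_ofReal
  rw [lintegral_finsetSum _ fun q _ => Finset.measurable_sum _ fun a _ => hmeas q a,
    Finset.mul_sum, ENNReal.ofReal_sum_of_nonneg fun q _ =>
      mul_nonneg (by positivity) (mul_nonneg (by positivity) (hM q))]
  refine Finset.sum_le_sum fun q hq => ?_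
  have hq1 : (1 : ℝ) ≤ q := by exact_mod_cast (Finset.mem_Icc.1 hq).1
  have hq0 : (0 : ℝ) < q := by linarith
  rw [lintegral_finsetSum _ fun a _ => hmeas q a]
  calc ∑ a ∈ numerators q, ∫⁻ t, ENNReal.ofReal (g q (t - a / q))
      = ∑ a ∈ numerators q, ∫⁻ τ, ENNReal.ofReal (g q τ) :=
        Finset.sum_congr rfl fun a _ =>
          lintegral_sub_right_eq_self (fun τ => ENNReal.ofReal (g q τ)) _
    _ ≤ ∑ a ∈ numerators q, ENNReal.ofReal (K * (q : ℝ) ^ (-(5 / 2) : ℝ) * M q) :=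
        Finset.sum_le_sum fun a _ => h q hq
    _ = ENNReal.ofReal ((numerators q).card * (K * (q : ℝ) ^ (-(5 / 2) : ℝ) * M q)) := by
        rw [Finset.sum_const, nsmul_eq_mul,
          ENNReal.ofReal_mul (p := ((numerators q).card : ℝ)) (by positivity),
          ENNReal.ofReal_natCast]
    _ ≤ _ := by
        refine ENNReal.ofReal_le_ofReal ?_
        have hc : ((numerators q).card : ℝ) ≤ 2 * q := by
          have : ((numerators q).card : ℝ) ≤ q + 1 := by exact_mod_cast card_numerators_le q
          linarith
        calc ((numerators q).card : ℝ) * (K * (q : ℝ) ^ (-(5 / 2) : ℝ) * M q)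
            ≤ 2 * q * (K * (q : ℝ) ^ (-(5 / 2) : ℝ) * M q) := by
              refine mul_le_mul_of_nonneg_right hc (mul_nonneg (by positivity) (hM q))
          _ = 2 * K * ((q : ℝ) ^ (-(3 / 2) : ℝ) * M q) := by
              rw [show (-(3 / 2) : ℝ) = -(5 / 2) + 1 by norm_num, Real.rpow_add hq0, Real.rpow_one]
              ring

theorem lintegral_fareyWeight_le {d : ℕ} (hd : 5 ≤ d) {ε : ℝ} (hε : 0 < ε) (Q : ℕ) :
    ∫⁻ t in Set.Ioc (0 : ℝ) 1, fareyWeight d ε Q t ≤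
      ENNReal.ofReal (2 * (decayIntegral * ε ^ (1 - (d : ℝ) / 2)) * decaySum) := by
  have hJ := decayIntegral_nonneg
  have h := lintegral_sum_arcs_le Q (arcWeight d ε) (measurable_arcWeight d ε)
    (K := decayIntegral * ε ^ (1 - (d : ℝ) / 2)) (by positivity) (fun _ => 1)
    (fun _ => zero_le_one) (fun q hq => by
      rw [mul_one]
      exact lintegral_arc_weight_le hd (Finset.mem_Icc.1 hq).1 hε)
  refine ((setLIntegral_le_lintegral _ _).trans (lintegral_mono fun t => ?_)).trans (h.trans ?_)
  · unfold fareyWeight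
    refine Finset.sum_le_sum fun q _ => Finset.sum_le_sum fun a _ => ?_
    exact Set.indicator_le_self' (fun _ _ => zero_le) t
  · refine ENNReal.ofReal_le_ofReal (mul_le_mul_of_nonneg_left ?_ (by positivity))
    simp_rw [mul_one]
    exact sum_rpow_le_decaySum _ fun q hq => (Finset.mem_Icc.1 hq).1

/-- A constant for which the bound of the theta function near rationals holds. -/
def thetaConst : ℝ := norm_sq_theta_le.choose

theorem thetaConst_pos : 0 < thetaConst := norm_sq_theta_le.choose_spec.1

theorem norm_sq_theta_le_thetaConst (ε t β τ D : ℝ) (q : ℕ) (a : ℤ) (hε : 0 < ε) (hq : 0 < q)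
    (ha : IsCoprime a (q : ℤ)) (ht : t = a / q + τ)
    (hκ : (q : ℝ) ^ 2 * (ε ^ 2 + τ ^ 2) ≤ 2 * ε) (hD : 0 ≤ D) (hDl : ∀ l : ℤ, D ≤ |β + l / q|) :
    ‖theta ε t β‖ ^ 2 ≤ thetaConst * ((q : ℝ) ^ 2 * (ε ^ 2 + τ ^ 2)) ^ (-(1 / 2) : ℝ) *
      Real.exp (-(ε * D ^ 2 / (ε ^ 2 + τ ^ 2))) :=
  norm_sq_theta_le.choose_spec.2 ε t β τ D q a hε hq ha ht hκ hD hDl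

theorem norm_sq_torusTheta_le
    {d q a : ℕ} {ε t D : ℝ} (hε : 0 < ε) (hq : 1 ≤ q) (ha : a ∈ numerators q)
    (harc : (q : ℝ) ^ 2 * (ε ^ 2 + (t - a / q) ^ 2) ≤ 2 * ε) (hD : 0 ≤ D) (β : Fin d → ℝ)
    (i : Fin d) (hDl : ∀ l : ℤ, D ≤ |β i + l / q|) :
    ‖torusTheta ε t (fun i => (β i : UnitAddCircle))‖ ^ 2 ≤
      thetaConst ^ d * arcWeight d ε q (t - a / q) ^ 2 *
        Real.exp (-(ε * D ^ 2 / (ε ^ 2 + (t - a / q) ^ 2))) := by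
  set τ := t - a / q with hτ
  have hq0 : (0 : ℝ) < q := by exact_mod_cast hq
  have hcop : IsCoprime (a : ℤ) (q : ℤ) :=
    (Nat.isCoprime_iff_coprime.2 (Finset.mem_filter.1 ha).2).symm
  have ht : t = ((a : ℤ) : ℝ) / q + τ := by rw [hτ]; push_cast; ring
  set v : ℝ := ((q : ℝ) ^ 2 * (ε ^ 2 + τ ^ 2)) ^ (-(1 / 2) : ℝ) with hv
  set E : ℝ := Real.exp (-(ε * D ^ 2 / (ε ^ 2 + τ ^ 2))) with hE
  have hbound : ∀ l, ‖theta ε t (β l)‖ ^ 2 ≤ thetaConst * v * (if l = i then E else 1) := by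
    intro l
    split_ifs with hl
    · rw [hl]
      exact norm_sq_theta_le_thetaConst ε t (β i) τ D q a hε hq hcop ht harc hD hDl
    · have := norm_sq_theta_le_thetaConst ε t (β l) τ 0 q a hε hq hcop ht harc le_rfl (fun _ => abs_nonneg _)
      simpa [hv] using this
  have hpow : v ^ d = arcWeight d ε q τ ^ 2 := by
    rw [hv, arcWeight, ← Real.rpow_mul_natCast (by positivity),
      ← Real.rpow_mul_natCast (by positivity)]
    congr 1
    push_cast
    ring
  rw [torusTheta_coe hε, norm_prod, ← Finset.prod_pow]
  refine (Finset.prod_le_prod (fun _ _ => by positivity) fun l _ => hbound l).trans (le_of_eq ?_)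
  rw [Finset.prod_mul_distrib, Finset.prod_const, Finset.card_univ, Fintype.card_fin, mul_pow, hpow,
    Finset.prod_ite_eq' Finset.univ i]
  simp

theorem lintegral_theta_div_fareyWeight_le
    {d j k : ℕ} (hd : 5 ≤ d) (hjk : 7 * j + 1 ≤ k) {α : UnitAddTorus (Fin d)}
    (hα : α ∉ Omega d j k) {ε : ℝ} (hε : ε = ((2 : ℝ) ^ (2 * k))⁻¹) :
    ∫⁻ t in Set.Ioc (0 : ℝ) 1, (fareyWeight d ε (2 ^ k) t)⁻¹ * ‖torusTheta ε t α‖ₑ ^ 2 ≤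
      ENNReal.ofReal (2 * (thetaConst ^ d * (decayIntegral * ε ^ (1 - (d : ℝ) / 2))) *
        (3 * decaySum * (2 : ℝ) ^ (-(5 / 4 * j) : ℝ))) := by
  classical
  have hC := thetaConst_pos
  have hε0 : 0 < ε := by rw [hε]; positivity
  have hJ := decayIntegral_nonneg
  obtain ⟨β, rfl⟩ : ∃ β : Fin d → ℝ, (fun i => (β i : UnitAddCircle)) = α := by
    choose β hβ using fun i => QuotientAddGroup.mk_surjective (α i)
    exact ⟨β, funext hβ⟩
  set η : ℝ := (2 : ℝ) ^ ((j : ℤ) - (k : ℤ)) with hη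
  have hη2 : η ^ 2 = ε * (2 : ℝ) ^ (2 * j) := by
    rw [hη, hε, zpow_sub₀ two_ne_zero, zpow_natCast, zpow_natCast, div_pow, ← pow_mul, ← pow_mul,
      mul_comm j, mul_comm k]
    ring
  obtain ⟨i, hi⟩ : ∃ i, ∀ l : ℤ, η < |β i + l / qLcm j| := by
    by_contra hcon
    push Not at hcon
    choose l hl using hcon
    refine hα ⟨fun i => β i + l i / qLcm j, fun i => -l i, hl, fun i => ?_⟩
    have : β i + l i / qLcm j + ((-l i : ℤ) : ℝ) / qLcm j = β i := by
      push_cast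
      ring
    simp only [this]
  set good : ℕ → Prop := fun q => ∀ l : ℤ, η ≤ |β i + l / q| with hgood
  set δ : ℝ := (2 : ℝ) ^ (-(5 / 4 * j) : ℝ) with hδ
  have hδ1 : δ ≤ 1 := Real.rpow_le_one_of_one_le_of_nonpos one_le_two (by
    have : (0 : ℝ) ≤ j := by positivity
    linarith)
  have hη0 : 0 ≤ η := by positivity
  let D : ℕ → ℝ := fun q => if good q then η else 0
  let M : ℕ → ℝ := fun q => if good q then δ else 1
  have hD0 : ∀ q, 0 ≤ D q := fun q => by
    simp only [D]; split_ifs <;> simp [hη0]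
  have hDl : ∀ (q : ℕ) (l : ℤ), D q ≤ |β i + l / q| := fun q l => by
    simp only [D]
    split_ifs with h
    · exact h l
    · exact abs_nonneg _
  have hM0 : ∀ q, 0 ≤ M q := fun q => by
    simp only [M]; split_ifs
    · positivity
    · exact zero_le_one
  let g : ℕ → ℝ → ℝ := fun q τ =>
    thetaConst ^ d * (arcWeight d ε q τ * Real.exp (-(ε * D q ^ 2 / (ε ^ 2 + τ ^ 2))))
  have hg : ∀ q, Measurable (g q) := fun q =>
    measurable_const.mul ((measurable_arcWeight d ε q).mul (by fun_prop))
  have hgint : ∀ q ∈ Finset.Icc 1 (2 ^ k), ∫⁻ τ, ENNReal.ofReal (g q τ) ≤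
      ENNReal.ofReal (thetaConst ^ d * (decayIntegral * ε ^ (1 - (d : ℝ) / 2)) *
        (q : ℝ) ^ (-(5 / 2) : ℝ) * M q) := by
    intro q hq
    have hq1 := (Finset.mem_Icc.1 hq).1
    simp only [g]
    simp_rw [ENNReal.ofReal_mul (by positivity : (0 : ℝ) ≤ thetaConst ^ d)]
    rw [lintegral_const_mul' _ _ ENNReal.ofReal_ne_top, mul_assoc, mul_assoc,
      ENNReal.ofReal_mul (by positivity)]
    gcongr 1
    simp only [D, M]
    split_ifs with h
    · rw [hη2]
      refine (lintegral_arc_weight_exp_le hd hq1 hε0 (by positivity)).trans (le_of_eq ?_)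
      congr 1
      have hY : ((2 : ℝ) ^ (2 * j)) ^ (-(5 / 8) : ℝ) = δ := by
        rw [← Real.rpow_natCast, ← Real.rpow_mul (by norm_num), hδ]
        congr 1
        push_cast
        ring
      rw [hY]
      ring
    · simp only [ne_eq, OfNat.ofNat_ne_zero, not_false_eq_true, zero_pow, mul_zero, zero_div,
        neg_zero, Real.exp_zero, mul_one]
      exact lintegral_arc_weight_le hd hq1 hε0
  refine le_trans ?_ ((lintegral_sum_arcs_le (2 ^ k) g hg (by positivity) M hM0 hgint).trans ?_)
  · refine le_trans (setLIntegral_mono' measurableSet_Ioc fun t ht => ?_)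
      (setLIntegral_le_lintegral _ _)
    obtain ⟨q, hq, a, ha, hta⟩ := exists_farey_arc (Nat.two_pow_pos k) ht
    have hq1 := (Finset.mem_Icc.1 hq).1
    have hq2 : (q : ℝ) ≤ 2 ^ k := by exact_mod_cast (Finset.mem_Icc.1 hq).2
    have hq0 : (0 : ℝ) < q := by exact_mod_cast hq1
    have hεk : ((2 : ℝ) ^ k) ^ 2 * ε = 1 := by
      rw [hε, ← pow_mul, mul_comm k 2, mul_inv_cancel₀ (by positivity)]
    have harc : (q : ℝ) ^ 2 * (ε ^ 2 + (t - a / q) ^ 2) ≤ 2 * ε := by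
      have h1 : (q : ℝ) ^ 2 * ε ^ 2 ≤ ε := by
        calc (q : ℝ) ^ 2 * ε ^ 2 ≤ ((2 : ℝ) ^ k) ^ 2 * ε ^ 2 := by gcongr
          _ = ε := by rw [sq ε, ← mul_assoc, hεk, one_mul]
      have h2 : (q : ℝ) ^ 2 * (t - a / q) ^ 2 ≤ ε := by
        rw [← mul_pow, ← sq_abs, abs_mul, abs_of_pos hq0]
        push_cast at hta
        calc ((q : ℝ) * |t - a / q|) ^ 2 ≤ (q * (1 / (q * 2 ^ k))) ^ 2 := by gcongr
          _ = (((2 : ℝ) ^ k) ^ 2)⁻¹ := by field_simp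
          _ = ε := by rw [hε, ← pow_mul, mul_comm k 2]
      linarith
    have hnorm := norm_sq_torusTheta_le hε0 hq1 ha harc (hD0 q) β i (hDl q)
    have hw := arcWeight_pos (d := d) hε0 hq1 (t - a / q)
    calc (fareyWeight d ε (2 ^ k) t)⁻¹ * ‖torusTheta ε t fun i => (β i : UnitAddCircle)‖ₑ ^ 2
        ≤ (ENNReal.ofReal (arcWeight d ε q (t - a / q)))⁻¹ * ENNReal.ofReal
          (thetaConst ^ d * arcWeight d ε q (t - a / q) ^ 2 *
            Real.exp (-(ε * D q ^ 2 / (ε ^ 2 + (t - a / q) ^ 2)))) := by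
          gcongr
          · exact ofReal_arcWeight_le_fareyWeight hq ha hta
          · rw [← ofReal_norm, ← ENNReal.ofReal_pow (norm_nonneg _)]
            exact ENNReal.ofReal_le_ofReal hnorm
      _ = ENNReal.ofReal (g q (t - a / q)) := by
          rw [← ENNReal.ofReal_inv_of_pos hw, ← ENNReal.ofReal_mul (by positivity)]
          congr 1
          simp only [g]
          field_simp
      _ ≤ ∑ a ∈ numerators q, ENNReal.ofReal (g q (t - a / q)) :=
          Finset.single_le_sum (f := fun a : ℕ => ENNReal.ofReal (g q (t - a / q)))
            (fun _ _ => zero_le) ha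
      _ ≤ _ := Finset.single_le_sum (f := fun q : ℕ => ∑ a ∈ numerators q,
            ENNReal.ofReal (g q (t - a / q))) (fun _ _ => zero_le) hq
  · refine ENNReal.ofReal_le_ofReal (mul_le_mul_of_nonneg_left ?_ (by positivity))
    refine sum_arc_decay_le hjk _ hi M (fun q => ?_) (fun q hq => ?_)
    · simp only [M]
      split_ifs
      · exact hδ1
      · exact le_rfl
    · simp only [M]
      rw [if_pos hq]

theorem dyadicMaximal_le {d : ℕ} {c : ℝ} (hc : 0 < c) (hd : 5 ≤ d)
    (hcard : ∀ N : ℕ, 1 ≤ N → c * (N : ℝ) ^ ((d : ℝ) / 2 - 1) ≤ (sphere d (Real.sqrt N)).card)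
    {k : ℕ} {ε : ℝ} (hε : ε = ((2 : ℝ) ^ (2 * k))⁻¹) (f : lp (fun _ : Fin d → ℤ => ℂ) 2)
    (n : Fin d → ℤ) :
    dyadicMaximal k (fun n => f n) n ≤
      ENNReal.ofReal (Real.exp (8 * Real.pi) / (c * ε ^ (1 - (d : ℝ) / 2))) *
        ∫⁻ t in Set.Ioc (0 : ℝ) 1, ‖gaussConv ε t f n‖ₑ := by
  have hε0 : 0 < ε := by rw [hε]; positivity
  have hd' : (5 : ℝ) ≤ d := by exact_mod_cast hd
  refine iSup₂_le fun lam hlam => ?_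
  obtain ⟨h1, h2, N, hN⟩ := hlam
  have hlam0 : 0 ≤ lam := le_trans (by positivity) h1
  have hlamN : lam = Real.sqrt N := by rw [← hN, Real.sqrt_sq hlam0]
  have hNlow : ε⁻¹ ≤ N := by
    rw [hε, inv_inv, ← hN, mul_comm, pow_mul]
    gcongr
  have hNup : ε * N ≤ 4 := by
    have : (N : ℝ) ≤ 4 * ε⁻¹ := by
      rw [hε, inv_inv, ← hN]
      calc lam ^ 2 ≤ (2 ^ (k + 1)) ^ 2 := by gcongr
        _ = 4 * 2 ^ (2 * k) := by ring
    calc ε * N ≤ ε * (4 * ε⁻¹) := by gcongr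
      _ = 4 := by field_simp
  have hN1 : 1 ≤ N := by
    have : (0 : ℝ) < N := lt_of_lt_of_le (by positivity) hNlow
    exact_mod_cast this
  have hcd : c * ε ^ (1 - (d : ℝ) / 2) ≤ (sphere d lam).card := by
    rw [hlamN]
    refine le_trans ?_ (hcard N hN1)
    rw [show 1 - (d : ℝ) / 2 = -((d : ℝ) / 2 - 1) by ring, Real.rpow_neg hε0.le,
      ← Real.inv_rpow hε0.le]
    gcongr
    linarith
  have hX : 0 < c * ε ^ (1 - (d : ℝ) / 2) := by positivity
  rw [sphericalAverage, enorm_mul]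
  have h3 := enorm_sum_sphere_le hε0 f n N
  rw [← hlamN] at h3
  have h4 : ‖((sphere d lam).card : ℂ)⁻¹‖ₑ ≤ ENNReal.ofReal (c * ε ^ (1 - (d : ℝ) / 2))⁻¹ := by
    rw [← ofReal_norm, norm_inv, Complex.norm_natCast]
    exact ENNReal.ofReal_le_ofReal (inv_anti₀ hX hcd)
  have h5 : ENNReal.ofReal (Real.exp (2 * Real.pi * ε * N)) ≤
      ENNReal.ofReal (Real.exp (8 * Real.pi)) := by
    refine ENNReal.ofReal_le_ofReal (Real.exp_le_exp.2 ?_)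
    nlinarith [Real.pi_pos]
  calc _ ≤ ENNReal.ofReal (c * ε ^ (1 - (d : ℝ) / 2))⁻¹ *
        (ENNReal.ofReal (Real.exp (8 * Real.pi)) *
          ∫⁻ t in Set.Ioc (0 : ℝ) 1, ‖gaussConv ε t f n‖ₑ) :=
        mul_le_mul' h4 (h3.trans (mul_le_mul' h5 le_rfl))
    _ = _ := by
        rw [← mul_assoc, ← ENNReal.ofReal_mul (by positivity)]
        congr 2
        ring

theorem seven_mul_add_one_le {j k : ℕ} (hj : 1 ≤ j) (h : (j : ℝ) ≤ Real.logb 2 (k : ℝ) - 2) :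
    7 * j + 1 ≤ k := by
  have hk : 0 < k := by
    rcases Nat.eq_zero_or_pos k with rfl | hk
    · have : (1 : ℝ) ≤ j := by exact_mod_cast hj
      norm_num at h
      linarith
    · exact hk
  have h1 : ((j + 2 : ℕ) : ℝ) ≤ Real.logb 2 (k : ℝ) := by
    push_cast
    linarith
  rw [Real.le_logb_iff_rpow_le one_lt_two (by exact_mod_cast hk), Real.rpow_natCast] at h1
  have h2 : 2 ^ (j + 2) ≤ k := by exact_mod_cast h1
  refine le_trans ?_ h2
  clear h h1 h2 hk
  induction j, hj using Nat.le_induction with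
  | base => norm_num
  | succ j hj ih =>
    rw [show j + 1 + 2 = (j + 2) + 1 by ring, pow_succ]
    omega

theorem rpow_neg_le_mul_inv {j : ℕ} (hj : 1 ≤ j) :
    (2 : ℝ) ^ (-(5 / 8 * j) : ℝ) ≤ 16 * (2 : ℝ) ^ (-(j : ℝ) / 2) * (j : ℝ)⁻¹ := by
  have hj0 : (0 : ℝ) < j := by exact_mod_cast hj
  have h1 : (j : ℝ) ≤ 16 * (2 : ℝ) ^ ((j : ℝ) / 8) := by
    rw [Real.rpow_def_of_pos two_pos]
    have h2 := Real.add_one_le_exp (Real.log 2 * ((j : ℝ) / 8))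
    have h3 := Real.log_two_gt_d9
    nlinarith
  have h4 : (2 : ℝ) ^ (-(j : ℝ) / 2) = (2 : ℝ) ^ (-(5 / 8 * j) : ℝ) * (2 : ℝ) ^ ((j : ℝ) / 8) := by
    rw [← Real.rpow_add two_pos]
    congr 1
    ring
  rw [← div_eq_mul_inv, le_div_iff₀ hj0, h4]
  have h5 : (0 : ℝ) < (2 : ℝ) ^ (-(5 / 8 * j) : ℝ) := by positivity
  nlinarith [mul_le_mul_of_nonneg_left h1 h5.le]

end DiscreteSpherical

end

theorem proposition2p1 (d : ℕ) (hd : 5 ≤ d) :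
    ∃ C : ℝ, 0 < C ∧ ∀ k j : ℕ, 1 ≤ j → (j : ℝ) ≤ Real.logb 2 (k : ℝ) - 2 →
      ∀ f : lp (fun _ : Fin d → ℤ => ℂ) 2,
        (∀ᵐ α ∂(DiscreteSpherical.torusMeasure d),
          α ∈ DiscreteSpherical.Omega d j k → DiscreteSpherical.fourierTransform f α = 0) →
        DiscreteSpherical.l2Norm (DiscreteSpherical.dyadicMaximal k (fun n => f n)) ≤
          ENNReal.ofReal (C * (2 : ℝ) ^ (-(j : ℝ) / 2) * (j : ℝ)⁻¹) *
            DiscreteSpherical.l2Norm (fun n => ‖f n‖ₑ) := by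
  open DiscreteSpherical in
  obtain ⟨c, hc, hcard⟩ := card_sphere_ge d hd
  have hC := thetaConst_pos
  have hJ := decayIntegral_nonneg
  have hZ := decaySum_nonneg
  set K : ℝ := (Real.exp (8 * Real.pi) / c) ^ 2 *
    (12 * thetaConst ^ d * decayIntegral ^ 2 * decaySum ^ 2) with hK
  have hK0 : 0 ≤ K := by positivity
  refine ⟨16 * (Real.sqrt K + 1), by positivity, fun k j hj hjk f hf => ?_⟩
  have hjk' := seven_mul_add_one_le hj hjk
  set ε : ℝ := ((2 : ℝ) ^ (2 * k))⁻¹ with hε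
  have hε0 : 0 < ε := by positivity
  set X : ℝ := ε ^ (1 - (d : ℝ) / 2) with hX
  have hX0 : 0 < X := by positivity
  set δ : ℝ := (2 : ℝ) ^ (-(5 / 4 * j) : ℝ) with hδ
  have hmain := tsum_sq_lintegral_gaussConv_le hε0 f (measurable_fareyWeight d ε (2 ^ k))
    (fun t ht => by
      obtain ⟨q, hq, a, ha, hta⟩ := exists_farey_arc (Nat.two_pow_pos k) ht
      refine (lt_of_lt_of_le ?_ (ofReal_arcWeight_le_fareyWeight hq ha hta)).ne'
      exact ENNReal.ofReal_pos.2 (arcWeight_pos hε0 (Finset.mem_Icc.1 hq).1 _))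
    (fareyWeight_ne_top d ε (2 ^ k))
    (B := ENNReal.ofReal (2 * (thetaConst ^ d * (decayIntegral * X)) * (3 * decaySum * δ))) (by
      filter_upwards [hf] with α hα hne
      exact lintegral_theta_div_fareyWeight_le hd hjk' (fun h => hne (hα h)) hε)
  have hA := lintegral_fareyWeight_le hd hε0 (2 ^ k)
  have hsum : ∑' n, dyadicMaximal k (fun n => f n) n ^ 2 ≤
      ENNReal.ofReal (K * δ) * ∑' n, ‖f n‖ₑ ^ 2 := by
    calc ∑' n, dyadicMaximal k (fun n => f n) n ^ 2
        ≤ ∑' n, ENNReal.ofReal (Real.exp (8 * Real.pi) / (c * X)) ^ 2 *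
            (∫⁻ t in Set.Ioc (0 : ℝ) 1, ‖gaussConv ε t f n‖ₑ) ^ 2 := by
          refine ENNReal.tsum_le_tsum fun n => ?_
          rw [← mul_pow]
          exact pow_le_pow_left₀ zero_le (dyadicMaximal_le hc hd hcard hε f n) 2
      _ ≤ ENNReal.ofReal (Real.exp (8 * Real.pi) / (c * X)) ^ 2 *
            (ENNReal.ofReal (2 * (decayIntegral * X) * decaySum) *
              (ENNReal.ofReal (2 * (thetaConst ^ d * (decayIntegral * X)) * (3 * decaySum * δ)) *
                ∑' n, ‖f n‖ₑ ^ 2)) := by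
          rw [ENNReal.tsum_mul_left]
          exact mul_le_mul' le_rfl (hmain.trans (mul_le_mul' hA le_rfl))
      _ = ENNReal.ofReal (K * δ) * ∑' n, ‖f n‖ₑ ^ 2 := by
          rw [← mul_assoc, ← mul_assoc, ← ENNReal.ofReal_pow (by positivity),
            ← ENNReal.ofReal_mul (by positivity), ← ENNReal.ofReal_mul (by positivity)]
          congr 2
          rw [hK]
          field_simp
          ring
  have hroot : l2Norm (dyadicMaximal k (fun n => f n)) ≤
      ENNReal.ofReal (Real.sqrt K * (2 : ℝ) ^ (-(5 / 8 * j) : ℝ)) * l2Norm (fun n => ‖f n‖ₑ) := by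
    unfold l2Norm
    refine (ENNReal.rpow_le_rpow hsum (by norm_num)).trans (le_of_eq ?_)
    rw [ENNReal.mul_rpow_of_nonneg _ _ (by norm_num),
      ENNReal.ofReal_rpow_of_nonneg (by positivity) (by norm_num), Real.mul_rpow hK0 (by positivity),
      hδ, ← Real.rpow_mul (by norm_num), ← Real.sqrt_eq_rpow]
    congr 4
    ring
  refine hroot.trans (mul_le_mul' (ENNReal.ofReal_le_ofReal ?_) le_rfl)
  have h1 := rpow_neg_le_mul_inv hj
  calc Real.sqrt K * (2 : ℝ) ^ (-(5 / 8 * j) : ℝ)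
      ≤ (Real.sqrt K + 1) * (16 * (2 : ℝ) ^ (-(j : ℝ) / 2) * (j : ℝ)⁻¹) := by
        gcongr
        linarith
    _ = _ := by ring
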